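/- For $n\in\mathbb{N}=\{0,1,2,\dots\}$ let $J_n$ and $Y_n$ be the Bessel functions of the first and second kind of order $n$, and for $n\ge 1$ and $x>0$ put $$C_n(x):=-Y_n(x)\left(\frac{x}{2}\right)^n\frac{\pi}{\Gamma(n)}.$$ For $m,p\in\mathbb{N}$ and $0\le r<1$ put $b_{m,p}:=2p+2m+1$, $c_m(r):=\dfrac{(2m-1)r}{1-r}$ and $$\alpha_{m,p}(r):=\begin{cases}\dfrac{1}{p+1}, & m=0,\\[2mm] \dfrac{2\left(b_{m,p}^m-c_m(r)^m\right)}{b_{m,p}-c_m(r)}, & m\ge 1,\end{cases}$$ where, at the value of $r$ with $b_{m,p}=c_m(r)$, the quotient is understood as its limit, so that $\alpha_{m,p}(r)=2m\,b_{m,p}^{m-1}$ there. Suppose $m,p\in\mathbb{N}$ and $x,y\in\mathbb{R}$ with $x>y\ge 0$ and $p+m\ge x$, and let $r=y/x$. Then the series on the left below converges and $$\sum_{n=p+1}^{\infty}|J_n(y)|\,|Y_{n+m}(x)|\le\frac{\alpha_{m,p}(r)\,C_{p+m+1}(x)\,r^{p+1}}{\pi x^m(1-r)}.$$ -/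

import Mathlib

noncomputable section

/-- The Bessel function of the first kind `J_n(x)` of order `n ∈ ℕ`, by its power series. -/
def besselJ (n : ℕ) (x : ℝ) : ℝ :=
  ∑' k : ℕ, (-1 : ℝ) ^ k / ((k.factorial : ℝ) * ((n + k).factorial : ℝ)) * (x / 2) ^ (2 * k + n)

/-- The value `ψ(k + 1) = -γ + (1 + 1/2 + ⋯ + 1/k)` of the digamma function. -/
def digammaSucc (k : ℕ) : ℝ := (harmonic k : ℝ) - Real.eulerMascheroniConstant

/-- The Bessel function of the second kind `Y_n(x)` of order `n ∈ ℕ`, for real `x > 0`: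
`Y_n(x) = -(1/π) (x/2)^(-n) ∑_{k<n} (n-k-1)!/k! (x²/4)^k + (2/π) log(x/2) J_n(x)
  - (1/π) (x/2)^n ∑_{k≥0} (ψ(k+1) + ψ(n+k+1)) (-x²/4)^k / (k! (n+k)!)`. -/
def besselY (n : ℕ) (x : ℝ) : ℝ :=
  -(1 / Real.pi) * ((x / 2) ^ n)⁻¹ *
      ∑ k ∈ Finset.range n,
        ((n - k - 1).factorial : ℝ) / (k.factorial : ℝ) * (x ^ 2 / 4) ^ k
    + 2 / Real.pi * Real.log (x / 2) * besselJ n x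
    - 1 / Real.pi * (x / 2) ^ n *
      ∑' k : ℕ, (digammaSucc k + digammaSucc (n + k)) * (-(x ^ 2 / 4)) ^ k /
        ((k.factorial : ℝ) * ((n + k).factorial : ℝ))

/-- `C_n(x) = -Y_n(x) (x/2)^n π / Γ(n)`, for `n ≥ 1` and `x > 0`. -/
def besselC (n : ℕ) (x : ℝ) : ℝ :=
  -besselY n x * (x / 2) ^ n * (Real.pi / Real.Gamma n)

/-- `b_{m,p} = 2p + 2m + 1`. -/
def bCoef (m p : ℕ) : ℝ := 2 * p + 2 * m + 1

/-- `c_m(r) = (2m - 1) r / (1 - r)`. -/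
def cCoef (m : ℕ) (r : ℝ) : ℝ := (2 * m - 1) * r / (1 - r)

open Classical in
/-- `α_{m,p}(r)`: equal to `1 / (p + 1)` for `m = 0`, and to `2 (b^m - c^m) / (b - c)` for `m ≥ 1`,
where `b = b_{m,p}` and `c = c_m(r)`. At the one value of `r` with `b = c` the quotient has a
removable singularity, and it stands for its limit `2 m b^(m-1)`. -/
def alphaCoef (m p : ℕ) (r : ℝ) : ℝ :=
  if m = 0 then 1 / ((p : ℝ) + 1)
  else if bCoef m p = cCoef m r then 2 * (m * bCoef m p ^ (m - 1))
  else 2 * (bCoef m p ^ m - cCoef m r ^ m) / (bCoef m p - cCoef m r)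

end

/-! Each term is bounded separately, and the resulting majorant is summed. Monotonicity of an energy
built from the power series gives `|J_n(y)| ≤ (y/2)^n / n!`. For `Y`, the recurrence makes
`C_{n+1}(x) - C_{n+2}(x)` a positive multiple of `-Y_n(x)`. So if `Y_n(x) ≤ 0` for `0 < x ≤ n`, then
every `C` beyond index `p+m+1` is at most `C_{p+m+1}(x)`, and `|Y_{n+m}(x)|` is at most this
constant times `(2/x)^(n+m) (n+m-1)!/π`. The powers combine to `r^n`, leaving `∑_{n>p} r^n
(n+m-1)!/n!`. For `m ≥ 1`, repeated Abel summation bounds this by the homogeneous polynomial `∑ b^i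
c^(m-1-i)` (`besselY_nonpos`, `besselC_succ_le`, `tsum_pow_mul_ascFactorial_le`).

The sign of `Y_n` is read off Schläfli's integral: its exponential part contributes nonpositively,
and an integration by parts shows the same for the oscillating part. Since `Y_n` is defined by its
series, the integral must first be identified with it. Both satisfy the same three-term recurrence,
so orders 0 and 1 suffice. There the differences solve a linear system with decreasing energy, and
they vanish at `0+`; this limit is where Euler's constant enters, through `Γ'(1) = -γ`. -/

/-! ### Exponential generating functions with bounded coefficients -/

/-- The exponential generating function `∑ a_k z^k / k!`. -/
noncomputable def egf (a : ℕ → ℝ) (z : ℝ) : ℝ := ∑' k : ℕ, a k * z ^ k / (k.factorial : ℝ)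

theorem egf_summable {a : ℕ → ℝ} {C : ℝ} (h : ∀ k, |a k| ≤ C) (z : ℝ) :
    Summable (fun k : ℕ => a k * z ^ k / (k.factorial : ℝ)) := by
  refine Summable.of_norm_bounded (g := fun k : ℕ => C * (|z| ^ k / (k.factorial : ℝ)))
    ((Real.summable_pow_div_factorial _).mul_left C) fun k => ?_
  rw [norm_div, norm_mul, norm_pow, Real.norm_eq_abs, Real.norm_eq_abs, Real.norm_natCast,
    mul_div_assoc]
  exact mul_le_mul_of_nonneg_right (h k) (by positivity)

theorem egf_hasSum {a : ℕ → ℝ} {C : ℝ} (h : ∀ k, |a k| ≤ C) (z : ℝ) :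
    HasSum (fun k : ℕ => a k * z ^ k / (k.factorial : ℝ)) (egf a z) :=
  (egf_summable h z).hasSum

/-- Puts `z * egf a z` back in the same form, so that recurrences reduce to comparing coefficients.
At `k = 0` the truncated index `k - 1` is harmless because of the factor `k`. -/
theorem egf_hasSum_mul {a : ℕ → ℝ} {C : ℝ} (h : ∀ k, |a k| ≤ C) (z : ℝ) :
    HasSum (fun k : ℕ => k * a (k - 1) * z ^ k / (k.factorial : ℝ)) (z * egf a z) := by
  rw [← hasSum_nat_add_iff' 1]
  simp only [Finset.range_one, Finset.sum_singleton, Nat.cast_zero, zero_mul, zero_div, sub_zero]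
  refine ((egf_hasSum h z).mul_left z).congr_fun fun k => ?_
  have : (k.factorial : ℝ) ≠ 0 := by positivity
  rw [Nat.factorial_succ, Nat.add_sub_cancel]
  push_cast
  field_simp
  ring

theorem egf_zero (a : ℕ → ℝ) : egf a 0 = a 0 := by
  rw [egf, tsum_eq_single 0]
  · simp
  · intro k hk
    simp [hk]

theorem egf_hasDerivAt {a : ℕ → ℝ} {C : ℝ} (h : ∀ k, |a k| ≤ C) (z : ℝ) :
    HasDerivAt (egf a) (egf (fun k => a (k + 1)) z) z := by
  have key : ∀ w : ℝ, ∀ k : ℕ, a (k + 1) * (((k + 1 : ℕ) : ℝ) * w ^ k) / ((k + 1).factorial : ℝ) =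
      a (k + 1) * w ^ k / (k.factorial : ℝ) := by
    intro w k
    have : (k.factorial : ℝ) ≠ 0 := by positivity
    rw [Nat.factorial_succ]
    push_cast
    field_simp
  -- Termwise differentiation on the ball of radius `|z| + 1`, where the derivative series has a
  -- uniform summable majorant.
  have hd := hasDerivAt_tsum_of_isPreconnected (𝕜 := ℝ)
    (g := fun (k : ℕ) (z : ℝ) => a k * z ^ k / (k.factorial : ℝ))
    (g' := fun (k : ℕ) (z : ℝ) => a k * (k * z ^ (k - 1)) / (k.factorial : ℝ))
    (u := fun k : ℕ => C * (k * (|z| + 1) ^ (k - 1)) / (k.factorial : ℝ))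
    (t := Metric.ball 0 (|z| + 1)) (y₀ := z) (y := z) ?_ Metric.isOpen_ball
    (convex_ball _ _).isPreconnected ?_ ?_ (by simp) (egf_summable h z) (by simp)
  · refine hd.congr_deriv ?_
    rw [Summable.tsum_eq_zero_add]
    · simp only [Nat.cast_zero, zero_mul, mul_zero, zero_div, zero_add, Nat.add_sub_cancel, egf]
      exact tsum_congr fun k => key z k
    · rw [← summable_nat_add_iff 1]
      simp only [Nat.add_sub_cancel, key]
      exact egf_summable (fun k => h (k + 1)) z
  · rw [← summable_nat_add_iff 1]
    refine ((Real.summable_pow_div_factorial (|z| + 1)).mul_left C).congr fun k => ?_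
    have : (k.factorial : ℝ) ≠ 0 := by positivity
    rw [Nat.factorial_succ, Nat.add_sub_cancel]
    push_cast
    field_simp
  · intro k w _
    exact ((hasDerivAt_pow k w).const_mul (a k)).div_const _
  · intro k w hw
    have hw' : |w| ≤ |z| + 1 := by simpa using (mem_ball_zero_iff.1 hw).le
    rw [norm_div, norm_mul, norm_mul, norm_pow, Real.norm_natCast, Real.norm_natCast,
      Real.norm_eq_abs, Real.norm_eq_abs]
    have := (abs_nonneg _).trans (h k)
    gcongr
    exact h k

theorem egf_continuous {a : ℕ → ℝ} {C : ℝ} (h : ∀ k, |a k| ≤ C) : Continuous (egf a) :=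
  continuous_iff_continuousAt.2 fun z => (egf_hasDerivAt h z).continuousAt

/-! ### The power series behind `J_n` and `Y_n`: recurrences and derivatives -/

noncomputable def besselPhiCoef (n k : ℕ) : ℝ := (-1) ^ k / ((n + k).factorial : ℝ)

noncomputable def besselGCoef (n k : ℕ) : ℝ :=
  (digammaSucc k + digammaSucc (n + k)) * (-1) ^ k / ((n + k).factorial : ℝ)

/-- `∑ (-z)^k / (k! (n+k)!)`, so that `J_n(x) = (x/2)^n besselPhi n (x²/4)`. -/
noncomputable def besselPhi (n : ℕ) : ℝ → ℝ := egf (besselPhiCoef n)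

/-- The digamma-weighted series in the definition of `Y_n`. -/
noncomputable def besselG (n : ℕ) : ℝ → ℝ := egf (besselGCoef n)

theorem besselPhiCoef_bound (n k : ℕ) : |besselPhiCoef n k| ≤ 1 := by
  rw [besselPhiCoef, abs_div, abs_pow, abs_neg, abs_one, one_pow, Nat.abs_cast]
  exact div_le_one_of_le₀ (by exact_mod_cast Nat.succ_le_of_lt (Nat.factorial_pos _))
    (by positivity)

theorem digammaSucc_succ (k : ℕ) : digammaSucc (k + 1) = digammaSucc k + 1 / ((k : ℝ) + 1) := by
  rw [digammaSucc, digammaSucc, harmonic_succ]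
  push_cast
  ring

theorem abs_digammaSucc_le (k : ℕ) : |digammaSucc k| ≤ k + 1 := by
  induction k with
  | zero =>
    have h1 := Real.one_half_lt_eulerMascheroniConstant
    have h2 := Real.eulerMascheroniConstant_lt_two_thirds
    rw [digammaSucc, abs_le]
    constructor <;> simp <;> linarith
  | succ k ih =>
    rw [digammaSucc_succ]
    have : |1 / ((k : ℝ) + 1)| ≤ 1 := by
      rw [abs_of_pos (by positivity)]
      exact div_le_one_of_le₀ (by linarith [k.cast_nonneg (α := ℝ)]) (by positivity)
    push_cast
    linarith [abs_add_le (digammaSucc k) (1 / ((k : ℝ) + 1))]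

/-- The two digamma values total at most `2(n+k+1)`, and `n+k+1 ≤ 2 (n+k)!`. -/
theorem besselGCoef_bound (n k : ℕ) : |besselGCoef n k| ≤ 4 := by
  rw [besselGCoef, abs_div, abs_mul, abs_pow, abs_neg, abs_one, one_pow, Nat.abs_cast, mul_one,
    div_le_iff₀ (by positivity)]
  have h1 := abs_digammaSucc_le k
  have h2 := abs_digammaSucc_le (n + k)
  have h3 := abs_add_le (digammaSucc k) (digammaSucc (n + k))
  have h4 : ((n + k : ℕ) : ℝ) + 1 ≤ 2 * ((n + k).factorial : ℝ) := by
    have : n + k + 1 ≤ 2 * (n + k).factorial := by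
      have := Nat.self_le_factorial (n + k)
      have := Nat.factorial_pos (n + k)
      omega
    exact_mod_cast this
  push_cast at *
  linarith [n.cast_nonneg (α := ℝ)]

theorem factorial_succ_cast (m : ℕ) : ((m + 1).factorial : ℝ) = (m + 1) * (m.factorial : ℝ) := by
  rw [Nat.factorial_succ]
  push_cast
  ring

theorem besselPhi_hasDerivAt (n : ℕ) (z : ℝ) :
    HasDerivAt (besselPhi n) (-besselPhi (n + 1) z) z := by
  refine (egf_hasDerivAt (besselPhiCoef_bound n) z).congr_deriv ?_
  simp only [besselPhi, egf]
  rw [← tsum_neg]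
  refine tsum_congr fun k => ?_
  rw [besselPhiCoef, besselPhiCoef, add_right_comm n 1 k, ← add_assoc, pow_succ]
  ring

theorem besselPhi_recurrence (n : ℕ) (z : ℝ) :
    besselPhi n z + z * besselPhi (n + 2) z = (n + 1) * besselPhi (n + 1) z := by
  have h := ((egf_hasSum (besselPhiCoef_bound n) z).add
    (egf_hasSum_mul (besselPhiCoef_bound (n + 2)) z)).sub
    ((egf_hasSum (besselPhiCoef_bound (n + 1)) z).mul_left ((n : ℝ) + 1))
  have h0 := h.unique (hasSum_zero.congr_fun fun k => ?_)
  · simp only [besselPhi]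
    linarith
  · rcases k with _ | k
    · simp only [besselPhiCoef, add_zero, factorial_succ_cast]
      have : (n.factorial : ℝ) ≠ 0 := by positivity
      push_cast
      field_simp
      simp
    · have e1 : n + (k + 1) = n + k + 1 := by ring
      have e2 : n + 2 + k = n + k + 1 + 1 := by ring
      have e3 : n + 1 + (k + 1) = n + k + 1 + 1 := by ring
      simp only [besselPhiCoef, Nat.add_sub_cancel, e1, e2, e3, factorial_succ_cast]
      have : (k.factorial : ℝ) ≠ 0 := by positivity
      have : ((n + k).factorial : ℝ) ≠ 0 := by positivity
      push_cast
      field_simp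
      ring

theorem hasSum_single_zero (c : ℝ) (z : ℝ) :
    HasSum (fun k : ℕ => (if k = 0 then c else 0) * z ^ k / (k.factorial : ℝ)) c := by
  have := hasSum_single (f := fun k : ℕ => (if k = 0 then c else 0) * z ^ k / (k.factorial : ℝ)) 0
    (fun k hk => by simp [hk])
  simpa using this

/-- The digamma increments cancel in every coefficient except `k = 0`. The defect left there is
cancelled in the recurrence of `Y_n` by the extra term of `besselP_recurrence`. -/
theorem besselG_recurrence (n : ℕ) (z : ℝ) :
    besselG n z + z * besselG (n + 2) z =
      (n + 1) * besselG (n + 1) z - 1 / ((n + 1).factorial : ℝ) := by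
  have h := ((egf_hasSum (besselGCoef_bound n) z).add
    (egf_hasSum_mul (besselGCoef_bound (n + 2)) z)).sub
    ((egf_hasSum (besselGCoef_bound (n + 1)) z).mul_left ((n : ℝ) + 1))
  have h0 := h.unique ((hasSum_single_zero (-(1 / ((n + 1).factorial : ℝ))) z).congr_fun
    fun k => ?_)
  · simp only [besselG]
    linarith
  · rcases k with _ | k
    · simp only [besselGCoef, add_zero, factorial_succ_cast, digammaSucc_succ]
      have : (n.factorial : ℝ) ≠ 0 := by positivity
      push_cast
      field_simp
      simp
      ring
    · have e1 : n + (k + 1) = n + k + 1 := by ring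
      have e2 : n + 2 + k = n + k + 1 + 1 := by ring
      have e3 : n + 1 + (k + 1) = n + k + 1 + 1 := by ring
      simp only [besselGCoef, Nat.add_sub_cancel, e1, e2, e3, factorial_succ_cast, digammaSucc_succ]
      have : (k.factorial : ℝ) ≠ 0 := by positivity
      have : ((n + k).factorial : ℝ) ≠ 0 := by positivity
      simp only [Nat.add_eq_zero_iff, one_ne_zero, and_false, if_false, zero_mul, zero_div]
      push_cast
      field_simp
      ring

/-- Coefficients are compared after multiplying by `z`. The increment `1/(k+1)` of `digammaSucc k`
produces `besselPhi n` without its constant term. -/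
theorem besselG_hasDerivAt (n : ℕ) {z : ℝ} (hz : z ≠ 0) :
    HasDerivAt (besselG n)
      (-besselG (n + 1) z + (besselPhi n z - 1 / (n.factorial : ℝ)) / z) z := by
  refine (egf_hasDerivAt (besselGCoef_bound n) z).congr_deriv ?_
  have hb : ∀ k, |besselGCoef n (k + 1)| ≤ 4 := fun k => besselGCoef_bound n (k + 1)
  have h := (((egf_hasSum_mul hb z).add
    (egf_hasSum_mul (besselGCoef_bound (n + 1)) z)).sub
    (egf_hasSum (besselPhiCoef_bound n) z))
  have h0 := h.unique ((hasSum_single_zero (-(1 / (n.factorial : ℝ))) z).congr_fun fun k => ?_)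
  · simp only [besselG, besselPhi]
    rw [eq_neg_add_iff_add_eq, eq_div_iff hz]
    linarith
  · rcases k with _ | k
    · simp [besselPhiCoef]
    · have e1 : n + (k + 1) = n + k + 1 := by ring
      have e3 : n + 1 + k = n + k + 1 := by ring
      simp only [besselGCoef, besselPhiCoef, Nat.add_sub_cancel, e1, e3, factorial_succ_cast,
        digammaSucc_succ]
      have : (k.factorial : ℝ) ≠ 0 := by positivity
      have : ((n + k).factorial : ℝ) ≠ 0 := by positivity
      simp only [Nat.add_eq_zero_iff, one_ne_zero, and_false, if_false, zero_mul, zero_div]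
      push_cast
      field_simp
      ring

theorem besselPhi_zero (n : ℕ) : besselPhi n 0 = 1 / (n.factorial : ℝ) := by
  rw [besselPhi, egf_zero, besselPhiCoef]
  simp

theorem besselPhi_continuous (n : ℕ) : Continuous (besselPhi n) :=
  egf_continuous (besselPhiCoef_bound n)

theorem besselG_continuous (n : ℕ) : Continuous (besselG n) :=
  egf_continuous (besselGCoef_bound n)

theorem besselJ_eq (n : ℕ) (x : ℝ) : besselJ n x = (x / 2) ^ n * besselPhi n (x ^ 2 / 4) := by
  rw [besselJ, besselPhi, egf, ← tsum_mul_left]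
  refine tsum_congr fun k => ?_
  rw [besselPhiCoef, pow_add, pow_mul, show (x / 2) ^ 2 = x ^ 2 / 4 by ring]
  field_simp

/-- The finite sum in the definition of `Y_n`. -/
noncomputable def besselP (n : ℕ) (z : ℝ) : ℝ :=
  ∑ k ∈ Finset.range n, ((n - k - 1).factorial : ℝ) / (k.factorial : ℝ) * z ^ k

theorem pi_mul_besselY (n : ℕ) (x : ℝ) : Real.pi * besselY n x =
    -((x / 2) ^ n)⁻¹ * besselP n (x ^ 2 / 4) +
      (x / 2) ^ n * (2 * Real.log (x / 2) * besselPhi n (x ^ 2 / 4) - besselG n (x ^ 2 / 4)) := by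
  have hG : ∑' k : ℕ, (digammaSucc k + digammaSucc (n + k)) * (-(x ^ 2 / 4)) ^ k /
        ((k.factorial : ℝ) * ((n + k).factorial : ℝ)) = besselG n (x ^ 2 / 4) := by
    rw [besselG, egf]
    refine tsum_congr fun k => ?_
    rw [besselGCoef, neg_pow]
    field_simp
  rw [besselY, hG, besselJ_eq, besselP]
  have := Real.pi_ne_zero
  field_simp
  ring

theorem besselP_recurrence (n : ℕ) (z : ℝ) :
    z * besselP n z + besselP (n + 2) z =
      (n + 1) * besselP (n + 1) z + z ^ (n + 1) / ((n + 1).factorial : ℝ) := by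
  -- After this shift, coefficients match by `k (n-k)! + (n+1-k)! = (n+1) (n-k)!`; the last term of
  -- `besselP (n + 2)` has no partner.
  have h1 : z * besselP n z = ∑ k ∈ Finset.range (n + 1),
      ((n - k).factorial : ℝ) * k / (k.factorial : ℝ) * z ^ k := by
    rw [Finset.sum_range_succ', besselP, Finset.mul_sum]
    simp only [Nat.cast_zero, mul_zero, zero_div, zero_mul, add_zero]
    refine Finset.sum_congr rfl fun k _ => ?_
    have : (k.factorial : ℝ) ≠ 0 := by positivity
    rw [factorial_succ_cast, Nat.sub_sub]
    push_cast
    field_simp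
    ring
  rw [h1, besselP, Finset.sum_range_succ _ (n + 1), besselP, Finset.mul_sum, ← add_assoc,
    ← Finset.sum_add_distrib]
  congr 1
  · refine Finset.sum_congr rfl fun k hk => ?_
    have hk' : k ≤ n := Nat.lt_succ_iff.1 (Finset.mem_range.1 hk)
    have : (k.factorial : ℝ) ≠ 0 := by positivity
    obtain ⟨j, rfl⟩ := Nat.exists_eq_add_of_le hk'
    have e1 : k + j - k = j := by omega
    have e2 : k + j + 2 - k - 1 = j + 1 := by omega
    have e3 : k + j + 1 - k - 1 = j := by omega
    rw [e1, e2, e3, factorial_succ_cast]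
    push_cast
    field_simp
    ring
  · have e : n + 2 - (n + 1) - 1 = 0 := by omega
    rw [e]
    simp
    ring

theorem besselY_recurrence (n : ℕ) {x : ℝ} (hx : 0 < x) :
    besselY n x + besselY (n + 2) x = 2 * (n + 1) / x * besselY (n + 1) x := by
  refine mul_left_cancel₀ Real.pi_ne_zero ?_
  have e : Real.pi * (2 * (n + 1) / x * besselY (n + 1) x) =
    2 * (n + 1) / x * (Real.pi * besselY (n + 1) x) := by ring
  rw [mul_add, e, pi_mul_besselY, pi_mul_besselY, pi_mul_besselY]
  obtain ⟨t, rfl⟩ : ∃ t, x = 2 * t := ⟨x / 2, by ring⟩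
  have ht : 0 < t := by linarith
  have e1 : 2 * t / 2 = t := by ring
  have e2 : (2 * t) ^ 2 / 4 = t ^ 2 := by ring
  rw [e1, e2]
  have hP := besselP_recurrence n (t ^ 2)
  have hF := besselPhi_recurrence n (t ^ 2)
  have hG := besselG_recurrence n (t ^ 2)
  have hP' : besselP (n + 2) (t ^ 2) = (n + 1) * besselP (n + 1) (t ^ 2) +
    (t ^ 2) ^ (n + 1) / ((n + 1).factorial : ℝ) - t ^ 2 * besselP n (t ^ 2) := by linarith
  have hF' : besselPhi n (t ^ 2) = (n + 1) * besselPhi (n + 1) (t ^ 2) -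
    t ^ 2 * besselPhi (n + 2) (t ^ 2) := by linarith
  have hG' : besselG n (t ^ 2) = (n + 1) * besselG (n + 1) (t ^ 2) -
    1 / ((n + 1).factorial : ℝ) - t ^ 2 * besselG (n + 2) (t ^ 2) := by linarith
  rw [hP', hF', hG']
  have : ((n + 1).factorial : ℝ) ≠ 0 := by positivity
  field_simp
  ring

/-! ### The bound for `J_n` -/

/-- The energy `Φ_n² + w Φ_{n+1}²` has derivative `-(2n+1) Φ_{n+1}²` by the recurrence, so on `w ≥
0` it stays below its value `(1/n!)²` at `0`. -/
theorem abs_besselPhi_le (n : ℕ) {z : ℝ} (hz : 0 ≤ z) :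
    |besselPhi n z| ≤ 1 / (n.factorial : ℝ) := by
  have hd : ∀ w, HasDerivAt (fun w => besselPhi n w ^ 2 + w * besselPhi (n + 1) w ^ 2)
      (-(2 * n + 1) * besselPhi (n + 1) w ^ 2) w := by
    intro w
    have h1 := (besselPhi_hasDerivAt n w).pow 2
    have h2 := (hasDerivAt_id w).mul ((besselPhi_hasDerivAt (n + 1) w).pow 2)
    refine (h1.add h2).congr_deriv ?_
    have hF := besselPhi_recurrence n w
    have hF' : besselPhi n w = (n + 1) * besselPhi (n + 1) w - w * besselPhi (n + 2) w := by
      linarith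
    simp only [hF', id, Pi.pow_apply]
    push_cast
    ring
  have hanti : Antitone (fun w => besselPhi n w ^ 2 + w * besselPhi (n + 1) w ^ 2) := by
    refine antitone_of_deriv_nonpos (fun w => (hd w).differentiableAt) fun w => ?_
    rw [(hd w).deriv, neg_mul]
    exact neg_nonpos.2 (by positivity)
  have h := hanti hz
  simp only [zero_mul, add_zero, besselPhi_zero] at h
  refine abs_le_of_sq_le_sq ?_ (by positivity)
  have : 0 ≤ z * besselPhi (n + 1) z ^ 2 := by positivity
  linarith

theorem abs_besselJ_le (n : ℕ) {y : ℝ} (hy : 0 ≤ y) :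
    |besselJ n y| ≤ (y / 2) ^ n / (n.factorial : ℝ) := by
  rw [besselJ_eq, abs_mul, abs_of_nonneg (by positivity : 0 ≤ (y / 2) ^ n),
    div_eq_mul_one_div _ (n.factorial : ℝ)]
  exact mul_le_mul_of_nonneg_left (abs_besselPhi_le n (by positivity)) (by positivity)

/-! ### The first-order system for `Y_0` and `Y_1` -/

theorem pi_mul_besselY_zero (x : ℝ) : Real.pi * besselY 0 x =
    2 * Real.log (x / 2) * besselPhi 0 (x ^ 2 / 4) - besselG 0 (x ^ 2 / 4) := by
  rw [pi_mul_besselY]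
  simp [besselP]

theorem pi_mul_besselY_one (x : ℝ) : Real.pi * besselY 1 x =
    -2 / x + x / 2 * (2 * Real.log (x / 2) * besselPhi 1 (x ^ 2 / 4) - besselG 1 (x ^ 2 / 4)) := by
  rw [pi_mul_besselY]
  simp [besselP]
  ring

theorem hasDerivAt_sq_div_four (x : ℝ) : HasDerivAt (fun x : ℝ => x ^ 2 / 4) (x / 2) x := by
  refine ((hasDerivAt_pow 2 x).div_const 4).congr_deriv ?_
  push_cast
  ring

theorem hasDerivAt_log_half {x : ℝ} (hx : 0 < x) :
    HasDerivAt (fun x : ℝ => Real.log (x / 2)) (1 / x) x := by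
  refine (((hasDerivAt_id x).div_const 2).log (by simp [hx.ne'])).congr_deriv ?_
  simp only [id]
  field_simp

theorem besselY_zero_hasDerivAt {x : ℝ} (hx : 0 < x) :
    HasDerivAt (fun x => Real.pi * besselY 0 x) (-(Real.pi * besselY 1 x)) x := by
  have hz : x ^ 2 / 4 ≠ 0 := by positivity
  have hF := (besselPhi_hasDerivAt 0 (x ^ 2 / 4)).comp x (hasDerivAt_sq_div_four x)
  have hG := (besselG_hasDerivAt 0 hz).comp x (hasDerivAt_sq_div_four x)
  have h := (((hasDerivAt_log_half hx).const_mul 2).mul hF).sub hG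
  simp only [pi_mul_besselY_zero, pi_mul_besselY_one]
  refine h.congr_deriv ?_
  simp only [Function.comp, Nat.factorial_zero, zero_add, Nat.cast_one]
  field_simp
  ring

theorem besselY_one_hasDerivAt {x : ℝ} (hx : 0 < x) :
    HasDerivAt (fun x => Real.pi * besselY 1 x)
      (Real.pi * besselY 0 x - Real.pi * besselY 1 x / x) x := by
  have hz : x ^ 2 / 4 ≠ 0 := by positivity
  have hF := (besselPhi_hasDerivAt 1 (x ^ 2 / 4)).comp x (hasDerivAt_sq_div_four x)
  have hG := (besselG_hasDerivAt 1 hz).comp x (hasDerivAt_sq_div_four x)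
  have h0 := ((hasDerivAt_id x).inv hx.ne').const_mul (-2)
  have h := h0.add (((hasDerivAt_id x).div_const 2).mul
    ((((hasDerivAt_log_half hx).const_mul 2).mul hF).sub hG))
  simp only [pi_mul_besselY_zero, pi_mul_besselY_one, div_eq_mul_inv (-2 : ℝ) _]
  refine h.congr_deriv ?_
  have rF := besselPhi_recurrence 0 (x ^ 2 / 4)
  have rG := besselG_recurrence 0 (x ^ 2 / 4)
  simp only [zero_add, Nat.cast_zero, one_mul, Nat.factorial_one, Nat.cast_one, div_one] at rF rG
  have rF' : besselPhi 0 (x ^ 2 / 4) = besselPhi 1 (x ^ 2 / 4) -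
    x ^ 2 / 4 * besselPhi 2 (x ^ 2 / 4) := by linarith
  have rG' : besselG 0 (x ^ 2 / 4) = besselG 1 (x ^ 2 / 4) - 1 -
    x ^ 2 / 4 * besselG 2 (x ^ 2 / 4) := by linarith
  rw [rF', rG']
  simp [Function.comp]
  field_simp
  ring

/-! ### Schläfli's integral: recurrence and derivative in `x` -/

section Schlaefli

open MeasureTheory Set Filter Topology

/-- The oscillating part `∫_0^π sin(x sin θ - ν θ) dθ` of Schläfli's integral for `π Y_ν(x)`. -/
noncomputable def schlaefliA (ν x : ℝ) : ℝ :=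
  ∫ θ in (0 : ℝ)..Real.pi, Real.sin (x * Real.sin θ - ν * θ)

/-- The decaying part `∫_0^∞ e^{νt - x sinh t} dt` of Schläfli's integral. -/
noncomputable def schlaefliE (ν x : ℝ) : ℝ :=
  ∫ t in Ioi (0 : ℝ), Real.exp (ν * t - x * Real.sinh t)

/-- Schläfli's integral for `π Y_ν(x)`. -/
noncomputable def schlaefliS (ν x : ℝ) : ℝ :=
  schlaefliA ν x - (schlaefliE ν x + Real.cos (ν * Real.pi) * schlaefliE (-ν) x)

theorem schlaefliA_intervalIntegrable (ν x a b : ℝ) :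
    IntervalIntegrable (fun θ => Real.sin (x * Real.sin θ - ν * θ)) volume a b :=
  Continuous.intervalIntegrable (by fun_prop) a b

/-- Integrates the derivative of `-cos(x sin θ - νθ)`. The boundary term is cancelled in
`schlaefliS_recurrence` by those of the two exponential integrals. -/
theorem schlaefliA_recurrence (ν : ℝ) {x : ℝ} (hx : 0 < x) :
    schlaefliA (ν - 1) x + schlaefliA (ν + 1) x =
      2 * ν / x * schlaefliA ν x + 2 / x * (1 - Real.cos (ν * Real.pi)) := by
  have hd : ∀ θ : ℝ, HasDerivAt (fun θ => -Real.cos (x * Real.sin θ - ν * θ))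
      (Real.sin (x * Real.sin θ - ν * θ) * (x * Real.cos θ - ν)) θ := by
    intro θ
    have h := (((Real.hasDerivAt_sin θ).const_mul x).sub ((hasDerivAt_id θ).const_mul ν)).cos.neg
    refine h.congr_deriv ?_
    simp
  have hFTC := intervalIntegral.integral_eq_sub_of_hasDerivAt (a := 0) (b := Real.pi)
    (fun θ _ => hd θ) (Continuous.intervalIntegrable (by fun_prop) _ _)
  simp only [Real.sin_pi, Real.sin_zero, mul_zero, zero_sub, sub_zero, Real.cos_neg,
    Real.cos_zero] at hFTC
  have e : schlaefliA (ν - 1) x + schlaefliA (ν + 1) x - 2 * ν / x * schlaefliA ν x =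
      2 / x * ∫ θ in (0 : ℝ)..Real.pi,
        Real.sin (x * Real.sin θ - ν * θ) * (x * Real.cos θ - ν) := by
    simp only [schlaefliA]
    rw [← intervalIntegral.integral_const_mul, ← intervalIntegral.integral_const_mul,
      ← intervalIntegral.integral_add (schlaefliA_intervalIntegrable _ _ _ _)
        (schlaefliA_intervalIntegrable _ _ _ _),
      ← intervalIntegral.integral_sub (Continuous.intervalIntegrable (by fun_prop) _ _)
        (Continuous.intervalIntegrable (by fun_prop) _ _)]
    refine intervalIntegral.integral_congr fun θ _ => ?_
    have e1 : x * Real.sin θ - (ν - 1) * θ = (x * Real.sin θ - ν * θ) + θ := by ring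
    have e2 : x * Real.sin θ - (ν + 1) * θ = (x * Real.sin θ - ν * θ) - θ := by ring
    simp only [e1, e2, Real.sin_add, Real.sin_sub]
    field_simp
    ring
  rw [hFTC] at e
  linarith

theorem schlaefliA_hasDerivAt (ν x : ℝ) :
    HasDerivAt (schlaefliA ν) ((schlaefliA (ν - 1) x - schlaefliA (ν + 1) x) / 2) x := by
  have h := intervalIntegral.hasDerivAt_integral_of_dominated_loc_of_deriv_le (𝕜 := ℝ)
    (μ := volume) (a := 0) (b := Real.pi) (s := univ) (x₀ := x) (bound := fun _ => 1)
    (F := fun x θ => Real.sin (x * Real.sin θ - ν * θ))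
    (F' := fun x θ => Real.sin θ * Real.cos (x * Real.sin θ - ν * θ)) univ_mem
    (Eventually.of_forall fun y => Continuous.aestronglyMeasurable (by fun_prop))
    (schlaefliA_intervalIntegrable _ _ _ _)
    (Continuous.aestronglyMeasurable (by fun_prop))
    (Eventually.of_forall fun θ _ y _ => ?_) (by simp)
    (Eventually.of_forall fun θ _ y _ => ?_)
  · refine h.2.congr_deriv ?_
    simp only [schlaefliA]
    rw [← intervalIntegral.integral_sub (schlaefliA_intervalIntegrable _ _ _ _)
      (schlaefliA_intervalIntegrable _ _ _ _), ← intervalIntegral.integral_div]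
    refine intervalIntegral.integral_congr fun θ _ => ?_
    have e1 : x * Real.sin θ - (ν - 1) * θ = (x * Real.sin θ - ν * θ) + θ := by ring
    have e2 : x * Real.sin θ - (ν + 1) * θ = (x * Real.sin θ - ν * θ) - θ := by ring
    simp only [e1, e2, Real.sin_add, Real.sin_sub]
    ring
  · rw [norm_mul, Real.norm_eq_abs, Real.norm_eq_abs]
    exact mul_le_one₀ (Real.abs_sin_le_one _) (abs_nonneg _) (Real.abs_cos_le_one _)
  · refine ((((hasDerivAt_id y).mul_const (Real.sin θ)).sub_const (ν * θ)).sin).congr_deriv ?_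
    simp [mul_comm]

theorem schlaefliA_continuous (ν : ℝ) : Continuous (schlaefliA ν) :=
  continuous_iff_continuousAt.2 fun x => (schlaefliA_hasDerivAt ν x).continuousAt

theorem sq_div_four_le_sinh {t : ℝ} (ht : 0 ≤ t) : t ^ 2 / 4 ≤ Real.sinh t := by
  have h1 := Real.quadratic_le_exp_of_nonneg ht
  have h2 : Real.exp (-t) ≤ 1 := Real.exp_le_one_iff.2 (by linarith)
  rw [Real.sinh_eq]
  linarith

/-- Completing the square with `sinh t ≥ t²/4`; this one majorant serves for both integrability and
decay at infinity. -/
theorem exp_schlaefli_le (ν : ℝ) {x t : ℝ} (hx : 0 < x) (ht : 0 ≤ t) :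
    Real.exp (ν * t - x * Real.sinh t) ≤ Real.exp ((ν + 1) ^ 2 / x) * Real.exp (-t) := by
  rw [← Real.exp_add, Real.exp_le_exp]
  have h1 := mul_le_mul_of_nonneg_left (sq_div_four_le_sinh ht) hx.le
  have h2 : (ν + 1) ^ 2 / x - (ν + 1) * t + x * (t ^ 2 / 4) = ((ν + 1) - x * t / 2) ^ 2 / x := by
    field_simp
    ring
  have h3 : 0 ≤ ((ν + 1) - x * t / 2) ^ 2 / x := by positivity
  linarith

theorem integrableOn_exp_schlaefli (ν : ℝ) {x : ℝ} (hx : 0 < x) :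
    IntegrableOn (fun t => Real.exp (ν * t - x * Real.sinh t)) (Ioi 0) := by
  have hg : IntegrableOn (fun t : ℝ => Real.exp ((ν + 1) ^ 2 / x) * Real.exp (-t)) (Ioi 0) :=
    (integrableOn_exp_neg_Ioi 0).const_mul _
  refine hg.mono' (Continuous.aestronglyMeasurable (by fun_prop)) ?_
  refine (ae_restrict_mem measurableSet_Ioi).mono fun t ht => ?_
  rw [Real.norm_eq_abs, Real.abs_exp]
  exact exp_schlaefli_le ν hx (le_of_lt ht)

theorem tendsto_exp_schlaefli (ν : ℝ) {x : ℝ} (hx : 0 < x) :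
    Tendsto (fun t => Real.exp (ν * t - x * Real.sinh t)) atTop (𝓝 0) := by
  have h : Tendsto (fun t : ℝ => Real.exp ((ν + 1) ^ 2 / x) * Real.exp (-t)) atTop (𝓝 0) := by
    simpa using (Real.tendsto_exp_neg_atTop_nhds_zero).const_mul (Real.exp ((ν + 1) ^ 2 / x))
  refine squeeze_zero' (Eventually.of_forall fun t => (Real.exp_pos _).le) ?_ h
  filter_upwards [eventually_ge_atTop 0] with t ht using exp_schlaefli_le ν hx ht

theorem exp_schlaefli_mul_exp (ν x t : ℝ) :
    Real.exp ((ν + 1) * t - x * Real.sinh t) =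
      Real.exp (ν * t - x * Real.sinh t) * Real.exp t := by
  rw [← Real.exp_add]
  ring_nf

theorem exp_schlaefli_mul_exp_neg (ν x t : ℝ) :
    Real.exp ((ν - 1) * t - x * Real.sinh t) =
      Real.exp (ν * t - x * Real.sinh t) * Real.exp (-t) := by
  rw [← Real.exp_add]
  ring_nf

theorem schlaefliE_recurrence (ν : ℝ) {x : ℝ} (hx : 0 < x) :
    schlaefliE (ν - 1) x + schlaefliE (ν + 1) x = 2 * ν / x * schlaefliE ν x + 2 / x := by
  have hint : ∀ μ, IntegrableOn (fun t => Real.exp (μ * t - x * Real.sinh t)) (Ioi 0) :=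
    fun μ => integrableOn_exp_schlaefli μ hx
  have hd : ∀ t : ℝ, HasDerivAt (fun t => Real.exp (ν * t - x * Real.sinh t))
      (ν * Real.exp (ν * t - x * Real.sinh t) - x / 2 *
        (Real.exp ((ν - 1) * t - x * Real.sinh t) + Real.exp ((ν + 1) * t - x * Real.sinh t))) t := by
    intro t
    have h := (((hasDerivAt_id t).const_mul ν).sub ((Real.hasDerivAt_sinh t).const_mul x)).exp
    refine h.congr_deriv ?_
    simp only [exp_schlaefli_mul_exp, exp_schlaefli_mul_exp_neg, Real.cosh_eq, Pi.sub_apply, id]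
    ring
  have hadd : IntegrableOn (fun t => Real.exp ((ν - 1) * t - x * Real.sinh t) +
      Real.exp ((ν + 1) * t - x * Real.sinh t)) (Ioi 0) := (hint (ν - 1)).add (hint (ν + 1))
  have h := integral_Ioi_of_hasDerivAt_of_tendsto (a := 0)
    (hd 0).continuousAt.continuousWithinAt (fun t _ => hd t)
    (((hint ν).const_mul ν).sub (hadd.const_mul (x / 2)))
    (tendsto_exp_schlaefli ν hx)
  rw [integral_sub ((hint ν).const_mul ν) (hadd.const_mul (x / 2)),
    integral_const_mul, integral_const_mul, integral_add (hint _) (hint _)] at h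
  simp only [mul_zero, Real.sinh_zero, sub_zero, Real.exp_zero] at h
  simp only [schlaefliE]
  field_simp
  linarith

theorem schlaefliE_hasDerivAt (ν : ℝ) {x : ℝ} (hx : 0 < x) :
    HasDerivAt (schlaefliE ν) ((schlaefliE (ν - 1) x - schlaefliE (ν + 1) x) / 2) x := by
  have hint : ∀ μ y, 0 < y → IntegrableOn (fun t => Real.exp (μ * t - y * Real.sinh t)) (Ioi 0) :=
    fun μ y hy => integrableOn_exp_schlaefli μ hy
  have key : ∀ y t : ℝ, -Real.sinh t * Real.exp (ν * t - y * Real.sinh t) =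
      (Real.exp ((ν - 1) * t - y * Real.sinh t) - Real.exp ((ν + 1) * t - y * Real.sinh t)) / 2 := by
    intro y t
    rw [exp_schlaefli_mul_exp, exp_schlaefli_mul_exp_neg, Real.sinh_eq]
    ring
  -- The integrand of the derivative shrinks in absolute value as the parameter grows, so its value
  -- at `x / 2` dominates on the neighbourhood `Ioi (x / 2)`.
  have h := hasDerivAt_integral_of_dominated_loc_of_deriv_le (𝕜 := ℝ)
    (μ := volume.restrict (Ioi 0)) (s := Ioi (x / 2)) (x₀ := x)
    (bound := fun t => Real.sinh t * Real.exp (ν * t - x / 2 * Real.sinh t))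
    (F := fun x t => Real.exp (ν * t - x * Real.sinh t))
    (F' := fun x t => -Real.sinh t * Real.exp (ν * t - x * Real.sinh t))
    (Ioi_mem_nhds (by linarith))
    (Eventually.of_forall fun y => Continuous.aestronglyMeasurable (by fun_prop))
    (hint ν x hx)
    (Continuous.aestronglyMeasurable (by fun_prop))
    ((ae_restrict_mem measurableSet_Ioi).mono fun t ht y hy => ?_) ?_
    (Eventually.of_forall fun t y _ => ?_)
  · refine h.2.congr_deriv ?_
    simp only [schlaefliE, key]
    rw [integral_div, integral_sub (hint _ _ hx) (hint _ _ hx)]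
  · have hs : 0 ≤ Real.sinh t := Real.sinh_nonneg_iff.2 (le_of_lt ht)
    rw [norm_mul, norm_neg, Real.norm_eq_abs, Real.norm_eq_abs, Real.abs_exp, abs_of_nonneg hs]
    have : x / 2 ≤ y := le_of_lt hy
    gcongr
  · have := ((hint (ν - 1) (x / 2) (by linarith)).sub (hint (ν + 1) (x / 2) (by linarith))).div_const
      (-2)
    refine this.congr (Eventually.of_forall fun t => ?_)
    have := key (x / 2) t
    simp only [Pi.sub_apply]
    linarith
  · refine ((((hasDerivAt_id y).mul_const (Real.sinh t)).const_sub (ν * t)).exp).congr_deriv ?_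
    simp [mul_comm]

theorem cos_add_one_mul_pi (ν : ℝ) :
    Real.cos ((ν + 1) * Real.pi) = -Real.cos (ν * Real.pi) := by
  rw [add_mul, one_mul, Real.cos_add_pi]

theorem cos_sub_one_mul_pi (ν : ℝ) :
    Real.cos ((ν - 1) * Real.pi) = -Real.cos (ν * Real.pi) := by
  rw [sub_mul, one_mul, Real.cos_sub_pi]

theorem schlaefliS_recurrence (ν : ℝ) {x : ℝ} (hx : 0 < x) :
    schlaefliS (ν - 1) x + schlaefliS (ν + 1) x = 2 * ν / x * schlaefliS ν x := by
  have h1 := schlaefliA_recurrence ν hx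
  have h2 := schlaefliE_recurrence ν hx
  have h3 := schlaefliE_recurrence (-ν) hx
  simp only [schlaefliS, cos_add_one_mul_pi, cos_sub_one_mul_pi]
  rw [show -(ν - 1) = -ν + 1 by ring, show -(ν + 1) = -ν - 1 by ring]
  linear_combination h1 - h2 + Real.cos (ν * Real.pi) * h3

theorem schlaefliS_hasDerivAt (ν : ℝ) {x : ℝ} (hx : 0 < x) :
    HasDerivAt (schlaefliS ν) ((schlaefliS (ν - 1) x - schlaefliS (ν + 1) x) / 2) x := by
  have h := (schlaefliA_hasDerivAt ν x).sub ((schlaefliE_hasDerivAt ν hx).add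
    ((schlaefliE_hasDerivAt (-ν) hx).const_mul (Real.cos (ν * Real.pi))))
  refine h.congr_deriv ?_
  simp only [schlaefliS, cos_add_one_mul_pi, cos_sub_one_mul_pi]
  rw [show -(ν - 1) = -ν + 1 by ring, show -(ν + 1) = -ν - 1 by ring]
  ring

/-! ### The sign of Schläfli's integral -/

theorem schlaefliE_nonneg (ν x : ℝ) : 0 ≤ schlaefliE ν x :=
  integral_nonneg fun _ => (Real.exp_pos _).le

theorem schlaefliE_neg_le {ν x : ℝ} (hν : 0 ≤ ν) (hx : 0 < x) :
    schlaefliE (-ν) x ≤ schlaefliE ν x := by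
  refine setIntegral_mono_on (integrableOn_exp_schlaefli _ hx) (integrableOn_exp_schlaefli _ hx)
    measurableSet_Ioi fun t ht => ?_
  have : 0 ≤ ν * t := mul_nonneg hν (le_of_lt ht)
  exact Real.exp_le_exp.2 (by linarith)

theorem schlaefliS_le_schlaefliA {ν x : ℝ} (hν : 0 ≤ ν) (hx : 0 < x) :
    schlaefliS ν x ≤ schlaefliA ν x := by
  have h1 := schlaefliE_neg_le hν hx
  have h2 := schlaefliE_nonneg (-ν) x
  have h3 := mul_le_mul_of_nonneg_right (Real.neg_one_le_cos (ν * Real.pi)) h2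
  rw [schlaefliS]
  linarith

/-- With phase `φ = x sin θ - nθ`, one has `sin φ = (cos φ - 1)' / (n - x cos θ)`. Integrating by
parts with `cos φ - 1` instead of `cos φ` gives the boundary term and the remainder a sign: the
former vanishes at `0` and is nonpositive at `π`. -/
theorem schlaefliA_nonpos_of_lt {n : ℕ} {x : ℝ} (hx : 0 < x) (hxn : x < n) :
    schlaefliA n x ≤ 0 := by
  have hpos : ∀ θ : ℝ, 0 < n - x * Real.cos θ := by
    intro θ
    have := mul_le_mul_of_nonneg_left (Real.cos_le_one θ) hx.le
    linarith
  have hd : ∀ θ : ℝ, HasDerivAt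
      (fun θ => (Real.cos (x * Real.sin θ - n * θ) - 1) / (n - x * Real.cos θ))
      (Real.sin (x * Real.sin θ - n * θ) + (1 - Real.cos (x * Real.sin θ - n * θ)) *
        (x * Real.sin θ) / (n - x * Real.cos θ) ^ 2) θ := by
    intro θ
    have h1 := (((Real.hasDerivAt_sin θ).const_mul x).sub
      ((hasDerivAt_id θ).const_mul (n : ℝ))).cos.sub_const 1
    have h2 := ((Real.hasDerivAt_cos θ).const_mul x).const_sub (n : ℝ)
    refine (h1.div h2 (hpos θ).ne').congr_deriv ?_
    have := (hpos θ).ne'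
    simp only [Pi.sub_apply, id]
    field_simp
    ring
  have hi : Continuous fun θ : ℝ => (1 - Real.cos (x * Real.sin θ - n * θ)) *
      (x * Real.sin θ) / (n - x * Real.cos θ) ^ 2 := by
    refine Continuous.div (by fun_prop) (by fun_prop) fun θ => ?_
    exact pow_ne_zero 2 (hpos θ).ne'
  have hFTC := intervalIntegral.integral_eq_sub_of_hasDerivAt (a := 0) (b := Real.pi)
    (fun θ _ => hd θ) ((schlaefliA_intervalIntegrable n x 0 Real.pi).add
      (hi.intervalIntegrable _ _))
  rw [intervalIntegral.integral_add (schlaefliA_intervalIntegrable n x 0 Real.pi)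
      (hi.intervalIntegrable _ _)] at hFTC
  have h0 : 0 ≤ ∫ θ in (0 : ℝ)..Real.pi, (1 - Real.cos (x * Real.sin θ - n * θ)) *
      (x * Real.sin θ) / (n - x * Real.cos θ) ^ 2 := by
    refine intervalIntegral.integral_nonneg Real.pi_pos.le fun θ hθ => ?_
    have := Real.sin_nonneg_of_mem_Icc hθ
    have := Real.cos_le_one (x * Real.sin θ - n * θ)
    have : 0 ≤ 1 - Real.cos (x * Real.sin θ - n * θ) := by linarith
    positivity
  have hπ : (Real.cos (x * Real.sin Real.pi - n * Real.pi) - 1) / (n - x * Real.cos Real.pi) ≤ 0 :=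
    div_nonpos_of_nonpos_of_nonneg
      (by linarith [Real.cos_le_one (x * Real.sin Real.pi - n * Real.pi)])
      (hpos _).le
  simp only [Real.sin_zero, mul_zero, sub_zero, Real.cos_zero, sub_self, zero_div] at hFTC
  rw [schlaefliA]
  linarith

theorem schlaefliA_nonpos {n : ℕ} {x : ℝ} (hx : 0 < x) (hxn : x ≤ n) : schlaefliA n x ≤ 0 := by
  have h : Tendsto (schlaefliA n) (𝓝[<] x) (𝓝 (schlaefliA n x)) :=
    (schlaefliA_continuous n).continuousAt.tendsto.mono_left nhdsWithin_le_nhds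
  refine le_of_tendsto h ?_
  filter_upwards [Ioo_mem_nhdsLT hx] with y hy
  exact schlaefliA_nonpos_of_lt hy.1 (hy.2.trans_le hxn)

/-! ### Behaviour at `0+` and Euler's constant -/

theorem integrableOn_log_mul_exp_neg_and_integral :
    IntegrableOn (fun u : ℝ => Real.log u * Real.exp (-u)) (Ioi 0) ∧
      ∫ u in Ioi (0 : ℝ), Real.log u * Real.exp (-u) = -Real.eulerMascheroniConstant := by
  -- Near `s = 1`, `Γ` is the Mellin transform of `e^(-t)`; differentiating under the integral
  -- inserts `log t`, and the value is `Γ'(1) = -γ`.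
  have h := mellin_hasDerivAt_of_isBigO_rpow (E := ℂ) (a := 2) (b := 0)
    (f := fun t : ℝ => ((Real.exp (-t) : ℝ) : ℂ)) (s := 1) ?_ ?_ (by norm_num) ?_ (by norm_num)
  · have hI : IntegrableOn (fun u : ℝ => ((Real.log u * Real.exp (-u) : ℝ) : ℂ)) (Ioi 0) := by
      have h1 := h.1
      rw [MellinConvergent] at h1
      refine h1.congr_fun (fun t _ => ?_) measurableSet_Ioi
      simp
    refine ⟨hI.re, ?_⟩
    have hΓ : HasDerivAt (mellin fun t : ℝ => ((Real.exp (-t) : ℝ) : ℂ))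
        (-(Real.eulerMascheroniConstant : ℂ)) 1 := by
      refine Complex.hasDerivAt_Gamma_one.congr_of_eventuallyEq ?_
      have : {s : ℂ | 0 < s.re} ∈ 𝓝 (1 : ℂ) :=
        (Complex.continuous_re.isOpen_preimage _ isOpen_Ioi).mem_nhds (by simp)
      filter_upwards [this] with s hs
      rw [Complex.Gamma_eq_integral hs, Complex.GammaIntegral_eq_mellin]
    have h2 := h.2.unique hΓ
    rw [mellin] at h2
    have h3 : ∫ u in Ioi (0 : ℝ), ((Real.log u * Real.exp (-u) : ℝ) : ℂ) =
        ((-Real.eulerMascheroniConstant : ℝ) : ℂ) := by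
      rw [Complex.ofReal_neg, ← h2]
      refine setIntegral_congr_fun measurableSet_Ioi fun t _ => ?_
      simp
    rw [integral_complex_ofReal] at h3
    exact_mod_cast h3
  · refine (Continuous.continuousOn ?_).locallyIntegrableOn measurableSet_Ioi
    exact Complex.continuous_ofReal.comp (Real.continuous_exp.comp continuous_neg)
  · rw [← Asymptotics.isBigO_norm_left]
    simp_rw [Complex.norm_real, Asymptotics.isBigO_norm_left]
    simpa only [neg_one_mul] using (isLittleO_exp_neg_mul_rpow_atTop zero_lt_one _).isBigO
  · simp_rw [neg_zero, Real.rpow_zero]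
    refine Asymptotics.isBigO_const_of_tendsto (?_ : Tendsto _ _ (𝓝 (1 : ℂ))) one_ne_zero
    rw [(by simp : (1 : ℂ) = Real.exp (-0))]
    exact (Complex.continuous_ofReal.comp
      (Real.continuous_exp.comp continuous_neg)).continuousWithinAt

theorem integrableOn_exp_neg_div {a : ℝ} (ha : 0 < a) :
    IntegrableOn (fun u : ℝ => Real.exp (-u) / u) (Ici a) := by
  rw [integrableOn_Ici_iff_integrableOn_Ioi]
  have hg : IntegrableOn (fun u : ℝ => a⁻¹ * Real.exp (-u)) (Ioi a) :=
    (integrableOn_exp_neg_Ioi a).const_mul _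
  refine hg.mono' (Measurable.aestronglyMeasurable (by fun_prop)) ?_
  refine (ae_restrict_mem measurableSet_Ioi).mono fun u hu => ?_
  have hu' : a < u := hu
  rw [norm_div, Real.norm_eq_abs, Real.norm_eq_abs, Real.abs_exp, abs_of_pos (ha.trans hu'),
    div_eq_inv_mul]
  gcongr

theorem tendsto_log_mul_exp_neg : Tendsto (fun u : ℝ => Real.log u * Real.exp (-u)) atTop (𝓝 0) := by
  have h : Tendsto (fun u : ℝ => u ^ 1 * Real.exp (-u)) atTop (𝓝 0) :=
    Real.tendsto_pow_mul_exp_neg_atTop_nhds_zero 1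
  refine squeeze_zero' ?_ ?_ h
  · filter_upwards [eventually_ge_atTop 1] with u hu
    exact mul_nonneg (Real.log_nonneg hu) (Real.exp_pos _).le
  · filter_upwards [eventually_ge_atTop 1] with u hu
    rw [pow_one]
    exact mul_le_mul_of_nonneg_right (Real.log_le_self (by linarith)) (Real.exp_pos _).le

theorem integral_exp_neg_div {a : ℝ} (ha : 0 < a) :
    ∫ u in Ioi a, Real.exp (-u) / u =
      (∫ u in Ioi a, Real.log u * Real.exp (-u)) - Real.log a * Real.exp (-a) := by
  have hd : ∀ u : ℝ, 0 < u → HasDerivAt (fun u : ℝ => Real.log u * Real.exp (-u))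
      (Real.exp (-u) / u - Real.log u * Real.exp (-u)) u := by
    intro u hu
    refine ((Real.hasDerivAt_log hu.ne').mul (hasDerivAt_neg u).exp).congr_deriv ?_
    field_simp
    ring
  have h1 : IntegrableOn (fun u : ℝ => Real.exp (-u) / u) (Ioi a) :=
    (integrableOn_exp_neg_div ha).mono_set Ioi_subset_Ici_self
  have h2 : IntegrableOn (fun u : ℝ => Real.log u * Real.exp (-u)) (Ioi a) :=
    integrableOn_log_mul_exp_neg_and_integral.1.mono_set (Ioi_subset_Ioi ha.le)
  have h := integral_Ioi_of_hasDerivAt_of_tendsto (hd a ha).continuousAt.continuousWithinAt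
    (fun u hu => hd u (ha.trans hu)) (h1.sub h2) tendsto_log_mul_exp_neg
  rw [integral_sub h1 h2] at h
  linarith

theorem exp_neg_mul_exp_le {a : ℝ} (ha : 0 < a) (t : ℝ) :
    Real.exp (-(a * Real.exp t)) ≤ a⁻¹ * Real.exp (-t) := by
  have h1 : a * Real.exp t ≤ Real.exp (a * Real.exp t) := by
    linarith [Real.add_one_le_exp (a * Real.exp t)]
  rw [Real.exp_neg, Real.exp_neg, ← mul_inv]
  exact inv_anti₀ (by positivity) h1

theorem integrableOn_exp_neg_mul_exp {a : ℝ} (ha : 0 < a) :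
    IntegrableOn (fun t : ℝ => Real.exp (-(a * Real.exp t))) (Ici 0) := by
  rw [integrableOn_Ici_iff_integrableOn_Ioi]
  have hg : IntegrableOn (fun u : ℝ => a⁻¹ * Real.exp (-u)) (Ioi 0) :=
    (integrableOn_exp_neg_Ioi 0).const_mul _
  refine hg.mono' (Continuous.aestronglyMeasurable (by fun_prop)) ?_
  refine Eventually.of_forall fun u => ?_
  rw [Real.norm_eq_abs, Real.abs_exp]
  exact exp_neg_mul_exp_le ha u

theorem integral_exp_neg_mul_exp {a : ℝ} (ha : 0 < a) :
    ∫ t in Ioi (0 : ℝ), Real.exp (-(a * Real.exp t)) = ∫ u in Ioi a, Real.exp (-u) / u := by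
  have hcomp : ∀ t : ℝ, ((fun u : ℝ => Real.exp (-u) / u) ∘ fun t => a * Real.exp t) t *
      (a * Real.exp t) = Real.exp (-(a * Real.exp t)) := by
    intro t
    simp only [Function.comp]
    field_simp
  have himg : (fun t : ℝ => a * Real.exp t) '' Ici 0 ⊆ Ici a := by
    rintro _ ⟨t, ht, rfl⟩
    exact le_mul_of_one_le_right ha.le (Real.one_le_exp ht)
  have h := integral_comp_mul_deriv_Ioi (f := fun t => a * Real.exp t)
    (f' := fun t => a * Real.exp t) (g := fun u => Real.exp (-u) / u) (a := 0)
    (by fun_prop) (Real.tendsto_exp_atTop.const_mul_atTop ha)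
    (fun t _ => ((Real.hasDerivAt_exp t).const_mul a).hasDerivWithinAt) ?_
    ((integrableOn_exp_neg_div ha).mono_set himg) ?_
  · simpa only [hcomp, Real.exp_zero, mul_one] using h
  · refine ContinuousOn.div (by fun_prop) (by fun_prop) ?_
    rintro _ ⟨t, _, rfl⟩
    positivity
  · simp only [hcomp]
    exact integrableOn_exp_neg_mul_exp ha

theorem tendsto_mul_log_nhdsGT : Tendsto (fun a : ℝ => a * Real.log a) (𝓝[>] 0) (𝓝 0) := by
  have h := Real.continuous_mul_log.tendsto 0
  simp only [zero_mul] at h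
  exact h.mono_left nhdsWithin_le_nhds

/-- The substitution `u = a e^t` gives the exponential integral, and parts turn it into `∫_a^∞ log u
e^(-u) du - e^(-a) log a`. The integral tends to `-γ`, and `(1 - e^(-a)) log a` tends to `0`. -/
theorem tendsto_integral_exp_neg_mul_exp_add_log :
    Tendsto (fun a : ℝ => (∫ t in Ioi (0 : ℝ), Real.exp (-(a * Real.exp t))) + Real.log a)
      (𝓝[>] 0) (𝓝 (-Real.eulerMascheroniConstant)) := by
  obtain ⟨hI, hγ⟩ := integrableOn_log_mul_exp_neg_and_integral
  have h1 : Tendsto (fun a : ℝ => ∫ u in Ioi a, Real.log u * Real.exp (-u)) (𝓝[>] 0)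
      (𝓝 (-Real.eulerMascheroniConstant)) := by
    have hc := aecover_Ioi_of_Ioi (μ := volume) (l := 𝓝[>] (0 : ℝ)) (a := id) (A := (0 : ℝ))
      (tendsto_id.mono_left nhdsWithin_le_nhds)
    have := hc.integral_tendsto_of_countably_generated hI
    rw [hγ] at this
    refine this.congr' ?_
    filter_upwards [self_mem_nhdsWithin] with a ha
    rw [Measure.restrict_restrict measurableSet_Ioi,
      inter_eq_left.2 (Ioi_subset_Ioi (le_of_lt ha))]
    rfl
  have h2 : Tendsto (fun a : ℝ => Real.log a * (1 - Real.exp (-a))) (𝓝[>] 0) (𝓝 0) := by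
    have h3 := tendsto_mul_log_nhdsGT.abs
    rw [abs_zero] at h3
    refine squeeze_zero_norm' ?_ h3
    filter_upwards [self_mem_nhdsWithin] with a ha
    have ha' : 0 < a := ha
    have h4 := Real.add_one_le_exp (-a)
    have h5 := Real.exp_le_one_iff.2 (neg_nonpos.2 ha'.le)
    rw [Real.norm_eq_abs, abs_mul, abs_mul, mul_comm]
    refine mul_le_mul_of_nonneg_right ?_ (abs_nonneg _)
    rw [abs_of_nonneg (by linarith), abs_of_pos ha']
    linarith
  have h := h1.add h2
  rw [add_zero] at h
  refine h.congr' ?_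
  filter_upwards [self_mem_nhdsWithin] with a ha
  rw [integral_exp_neg_mul_exp ha, integral_exp_neg_div ha]
  ring

theorem exp_sub_one_le (s : ℝ) : Real.exp s - 1 ≤ s * Real.exp s := by
  have h := mul_le_mul_of_nonneg_right (Real.add_one_le_exp (-s)) (Real.exp_pos s).le
  rw [← Real.exp_add, neg_add_cancel, Real.exp_zero] at h
  linarith

/-- Replacing `x sinh t` by `(x/2) e^t` changes the integral by at most `(x/2) e^(x/2)`, which
reduces the limit to the previous one with `a = x/2`. -/
theorem tendsto_schlaefliE_zero_add_log :
    Tendsto (fun x : ℝ => schlaefliE 0 x + Real.log (x / 2)) (𝓝[>] 0)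
      (𝓝 (-Real.eulerMascheroniConstant)) := by
  have hhalf : Tendsto (fun x : ℝ => x / 2) (𝓝[>] 0) (𝓝[>] 0) := by
    refine tendsto_nhdsWithin_iff.2 ⟨?_, ?_⟩
    · have : Tendsto (fun x : ℝ => x / 2) (𝓝 0) (𝓝 (0 / 2)) := tendsto_id.div_const 2
      rw [zero_div] at this
      exact this.mono_left nhdsWithin_le_nhds
    · filter_upwards [self_mem_nhdsWithin] with x hx
      exact half_pos (mem_Ioi.1 hx)
  have h1 := tendsto_integral_exp_neg_mul_exp_add_log.comp hhalf
  have h2 : Tendsto (fun x : ℝ => schlaefliE 0 x -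
      ∫ t in Ioi (0 : ℝ), Real.exp (-(x / 2 * Real.exp t))) (𝓝[>] 0) (𝓝 0) := by
    have hlim : Tendsto (fun x : ℝ => x / 2 * Real.exp (x / 2)) (𝓝[>] 0) (𝓝 0) := by
      have : Continuous fun x : ℝ => x / 2 * Real.exp (x / 2) := by fun_prop
      have := this.tendsto 0
      simp only [zero_div, zero_mul] at this
      exact this.mono_left nhdsWithin_le_nhds
    refine squeeze_zero_norm' ?_ hlim
    filter_upwards [self_mem_nhdsWithin] with x hx
    have hx' : 0 < x := hx
    have hI1 := integrableOn_exp_schlaefli 0 hx'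
    have hI2 := (integrableOn_exp_neg_mul_exp (half_pos hx')).mono_set
      (Ioi_subset_Ici_self (a := (0 : ℝ)))
    rw [schlaefliE, ← integral_sub hI1 hI2]
    have hg : IntegrableOn (fun u : ℝ => x / 2 * Real.exp (x / 2) * Real.exp (-u)) (Ioi 0) :=
      (integrableOn_exp_neg_Ioi 0).const_mul _
    have hb := norm_integral_le_of_norm_le (f := fun t : ℝ => Real.exp (0 * t - x * Real.sinh t) -
      Real.exp (-(x / 2 * Real.exp t))) hg
      ((ae_restrict_mem measurableSet_Ioi).mono fun t ht => ?_)
    · rwa [integral_const_mul, integral_exp_neg_Ioi_zero, mul_one] at hb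
    · have ht' : 0 < t := ht
      have he : Real.exp (0 * t - x * Real.sinh t) - Real.exp (-(x / 2 * Real.exp t)) =
          Real.exp (-(x / 2 * Real.exp t)) * (Real.exp (x / 2 * Real.exp (-t)) - 1) := by
        rw [mul_sub, ← Real.exp_add, Real.sinh_eq]
        ring_nf
      have h3 : Real.exp (-(x / 2 * Real.exp t)) ≤ 1 :=
        Real.exp_le_one_iff.2 (neg_nonpos.2 (by positivity))
      have h4 : (1 : ℝ) ≤ Real.exp (x / 2 * Real.exp (-t)) := Real.one_le_exp (by positivity)
      have h5 : Real.exp (-t) ≤ 1 := Real.exp_le_one_iff.2 (by linarith)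
      rw [he, Real.norm_eq_abs, abs_of_nonneg (mul_nonneg (Real.exp_pos _).le (by linarith))]
      calc Real.exp (-(x / 2 * Real.exp t)) * (Real.exp (x / 2 * Real.exp (-t)) - 1)
          ≤ 1 * (Real.exp (x / 2 * Real.exp (-t)) - 1) := by gcongr
        _ ≤ x / 2 * Real.exp (-t) * Real.exp (x / 2 * Real.exp (-t)) := by
          rw [one_mul]
          exact exp_sub_one_le _
        _ ≤ x / 2 * Real.exp (-t) * Real.exp (x / 2 * 1) := by gcongr
        _ = _ := by ring_nf
  have h := h2.add h1
  rw [zero_add] at h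
  refine h.congr fun x => ?_
  simp only [Function.comp]
  ring

theorem tendsto_schlaefliE_neg_one : Tendsto (schlaefliE (-1)) (𝓝[>] 0) (𝓝 1) := by
  have h := tendsto_integral_filter_of_dominated_convergence (μ := volume.restrict (Ioi (0 : ℝ)))
    (l := 𝓝[>] (0 : ℝ)) (F := fun x t => Real.exp (-1 * t - x * Real.sinh t))
    (f := fun t => Real.exp (-t)) (fun t => Real.exp (-t))
    (Eventually.of_forall fun x => Continuous.aestronglyMeasurable (by fun_prop)) ?_
    (integrableOn_exp_neg_Ioi 0) (Eventually.of_forall fun t => ?_)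
  · rwa [integral_exp_neg_Ioi_zero] at h
  · filter_upwards [self_mem_nhdsWithin] with x hx
    refine (ae_restrict_mem measurableSet_Ioi).mono fun t ht => ?_
    have : 0 ≤ x * Real.sinh t := mul_nonneg (le_of_lt hx) (Real.sinh_nonneg_iff.2 (le_of_lt ht))
    rw [Real.norm_eq_abs, Real.abs_exp, Real.exp_le_exp]
    linarith
  · have : Continuous fun x : ℝ => Real.exp (-1 * t - x * Real.sinh t) := by fun_prop
    have := this.tendsto 0
    simp only [zero_mul, sub_zero, neg_one_mul] at this
    simpa only [neg_one_mul] using this.mono_left nhdsWithin_le_nhds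

theorem abs_besselPhi_zero_sub_one_le {z : ℝ} (hz : 0 ≤ z) : |besselPhi 0 z - 1| ≤ z := by
  have h := Convex.norm_image_sub_le_of_norm_hasDerivWithin_le (f := besselPhi 0)
    (f' := fun z => -besselPhi 1 z) (s := Ici 0) (x := 0) (y := z) (C := 1)
    (fun w _ => (besselPhi_hasDerivAt 0 w).hasDerivWithinAt) (fun w hw => ?_) (convex_Ici 0)
    self_mem_Ici hz
  · simpa [besselPhi_zero, abs_of_nonneg hz] using h
  · rw [norm_neg, Real.norm_eq_abs]
    simpa using abs_besselPhi_le 1 hw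

theorem tendsto_nhdsGT_zero_of_continuous {f : ℝ → ℝ} (hf : Continuous f) :
    Tendsto f (𝓝[>] 0) (𝓝 (f 0)) :=
  (hf.tendsto 0).mono_left nhdsWithin_le_nhds

theorem tendsto_half_mul_log_half :
    Tendsto (fun x : ℝ => x / 2 * Real.log (x / 2)) (𝓝[>] 0) (𝓝 0) := by
  have h : Continuous fun x : ℝ => x / 2 * Real.log (x / 2) :=
    Real.continuous_mul_log.comp (continuous_id.div_const 2)
  simpa using tendsto_nhdsGT_zero_of_continuous h

theorem schlaefliA_zero_zero : schlaefliA 0 0 = 0 := by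
  simp [schlaefliA]

theorem schlaefliA_one_zero : schlaefliA 1 0 = -2 := by
  simp only [schlaefliA, zero_mul, one_mul, zero_sub, Real.sin_neg, intervalIntegral.integral_neg,
    integral_sin, Real.cos_zero, Real.cos_pi]
  norm_num

theorem schlaefliS_zero_eq (x : ℝ) :
    schlaefliS 0 x = schlaefliA 0 x - 2 * schlaefliE 0 x := by
  rw [schlaefliS, neg_zero, zero_mul, Real.cos_zero]
  ring

/-- The recurrence at `ν = 0` trades the unbounded `schlaefliE 1` for `schlaefliE (-1)`, which
converges at `0+`, and isolates the pole `-2/x` that `π Y_1` also has. -/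
theorem schlaefliS_one_eq {x : ℝ} (hx : 0 < x) :
    schlaefliS 1 x = schlaefliA 1 x + 2 * schlaefliE (-1) x - 2 / x := by
  have h := schlaefliE_recurrence 0 hx
  rw [zero_sub, zero_add, mul_zero, zero_div, zero_mul, zero_add] at h
  rw [schlaefliS, one_mul, Real.cos_pi]
  linarith

/-! ### Identification of Schläfli's integral with `π Y_n` -/

/-- The logarithms cancel up to `log(x/2) (Φ_0 - 1)`, which is negligible because `|Φ_0 - 1| ≤
x²/4`. The constants cancel because `besselG 0 0 = -2γ`. -/
theorem tendsto_schlaefliS_zero_sub_besselY :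
    Tendsto (fun x => schlaefliS 0 x - Real.pi * besselY 0 x) (𝓝[>] 0) (𝓝 0) := by
  have h1 := tendsto_nhdsGT_zero_of_continuous (schlaefliA_continuous 0)
  have h2 := tendsto_schlaefliE_zero_add_log.const_mul 2
  have h3 : Tendsto (fun x : ℝ => Real.log (x / 2) * (besselPhi 0 (x ^ 2 / 4) - 1))
      (𝓝[>] 0) (𝓝 0) := by
    have h4 : Tendsto (fun x : ℝ => |x / 2 * Real.log (x / 2)| * |x / 2|) (𝓝[>] 0) (𝓝 0) := by
      have h5 := tendsto_nhdsGT_zero_of_continuous (f := fun x : ℝ => |x / 2|) (by fun_prop)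
      simpa using tendsto_half_mul_log_half.abs.mul h5
    refine squeeze_zero_norm (fun x => ?_) h4
    have h6 := abs_besselPhi_zero_sub_one_le (z := x ^ 2 / 4) (by positivity)
    calc ‖Real.log (x / 2) * (besselPhi 0 (x ^ 2 / 4) - 1)‖
        = |Real.log (x / 2)| * |besselPhi 0 (x ^ 2 / 4) - 1| := by
          rw [Real.norm_eq_abs, abs_mul]
      _ ≤ |Real.log (x / 2)| * (x ^ 2 / 4) := by gcongr
      _ = |Real.log (x / 2)| * (|x / 2| * |x / 2|) := by
          rw [abs_mul_abs_self]
          ring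
      _ = _ := by
          rw [abs_mul]
          ring
  have h7 := tendsto_nhdsGT_zero_of_continuous (f := fun x : ℝ => besselG 0 (x ^ 2 / 4))
    ((besselG_continuous 0).comp (by fun_prop))
  have h := ((h1.sub h2).sub (h3.const_mul 2)).add h7
  have hG : besselG 0 ((0 : ℝ) ^ 2 / 4) = -2 * Real.eulerMascheroniConstant := by
    rw [show ((0 : ℝ) ^ 2 / 4) = 0 by norm_num, besselG, egf_zero, besselGCoef, digammaSucc]
    simp
    ring
  have hlim : schlaefliA 0 0 - 2 * -Real.eulerMascheroniConstant - 2 * 0 +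
      besselG 0 ((0 : ℝ) ^ 2 / 4) = 0 := by
    rw [hG, schlaefliA_zero_zero]
    ring
  rw [hlim] at h
  refine h.congr fun x => ?_
  rw [schlaefliS_zero_eq, pi_mul_besselY_zero]
  ring

theorem tendsto_schlaefliS_one_sub_besselY :
    Tendsto (fun x => schlaefliS 1 x - Real.pi * besselY 1 x) (𝓝[>] 0) (𝓝 0) := by
  have h1 := tendsto_nhdsGT_zero_of_continuous (schlaefliA_continuous 1)
  have h2 := tendsto_schlaefliE_neg_one.const_mul 2
  have h3 := tendsto_nhdsGT_zero_of_continuous (f := fun x : ℝ => besselPhi 1 (x ^ 2 / 4))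
    ((besselPhi_continuous 1).comp (by fun_prop))
  have h4 := tendsto_nhdsGT_zero_of_continuous
    (f := fun x : ℝ => x / 2 * besselG 1 (x ^ 2 / 4))
    (Continuous.mul (by fun_prop) ((besselG_continuous 1).comp (by fun_prop)))
  have h := ((h1.add h2).sub ((tendsto_half_mul_log_half.const_mul 2).mul h3)).add h4
  have hlim : schlaefliA 1 0 + 2 * 1 - 2 * 0 * besselPhi 1 ((0 : ℝ) ^ 2 / 4) +
      0 / 2 * besselG 1 ((0 : ℝ) ^ 2 / 4) = 0 := by
    rw [schlaefliA_one_zero]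
    ring
  rw [hlim] at h
  refine h.congr' ?_
  filter_upwards [self_mem_nhdsWithin] with x hx
  rw [schlaefliS_one_eq hx, pi_mul_besselY_one]
  ring

/-- The differences satisfy `u' = -v` and `v' = u - v/y`, so `u² + v²` has derivative `-2v²/y ≤ 0`.
Being nonincreasing with limit `0` at `0+`, it vanishes identically. -/
theorem schlaefliS_zero_one_eq {x : ℝ} (hx : 0 < x) :
    schlaefliS 0 x = Real.pi * besselY 0 x ∧ schlaefliS 1 x = Real.pi * besselY 1 x := by
  set u : ℝ → ℝ := fun x => schlaefliS 0 x - Real.pi * besselY 0 x with hu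
  set v : ℝ → ℝ := fun x => schlaefliS 1 x - Real.pi * besselY 1 x with hv
  have hdu : ∀ y, 0 < y → HasDerivAt u (-v y) y := by
    intro y hy
    refine ((schlaefliS_hasDerivAt 0 hy).sub (besselY_zero_hasDerivAt hy)).congr_deriv ?_
    have := schlaefliS_recurrence 0 hy
    simp only [hv, zero_add, mul_zero, zero_div, zero_mul] at this ⊢
    linear_combination this / 2
  have hdv : ∀ y, 0 < y → HasDerivAt v (u y - v y / y) y := by
    intro y hy
    refine ((schlaefliS_hasDerivAt 1 hy).sub (besselY_one_hasDerivAt hy)).congr_deriv ?_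
    have := schlaefliS_recurrence 1 hy
    simp only [hu, hv, sub_self] at this ⊢
    linear_combination -this / 2
  have hd : ∀ y, 0 < y → HasDerivAt (fun y => u y ^ 2 + v y ^ 2) (-2 * v y ^ 2 / y) y := by
    intro y hy
    refine (((hdu y hy).pow 2).add ((hdv y hy).pow 2)).congr_deriv ?_
    push_cast
    ring
  have hanti : AntitoneOn (fun y => u y ^ 2 + v y ^ 2) (Ioi 0) := by
    refine antitoneOn_of_deriv_nonpos (convex_Ioi 0)
      (fun y hy => (hd y hy).continuousAt.continuousWithinAt) ?_ ?_
    · rw [interior_Ioi]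
      exact fun y hy => (hd y hy).differentiableAt.differentiableWithinAt
    · rw [interior_Ioi]
      intro y hy
      have hy' : 0 < y := hy
      rw [(hd y hy).deriv, neg_mul, neg_div]
      exact neg_nonpos.2 (by positivity)
  have hlim : Tendsto (fun y => u y ^ 2 + v y ^ 2) (𝓝[>] 0) (𝓝 0) := by
    simpa using (tendsto_schlaefliS_zero_sub_besselY.pow 2).add
      (tendsto_schlaefliS_one_sub_besselY.pow 2)
  have hle : u x ^ 2 + v x ^ 2 ≤ 0 := by
    refine ge_of_tendsto hlim ?_
    filter_upwards [Ioo_mem_nhdsGT hx] with y hy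
    exact hanti hy.1 hx hy.2.le
  have hu0 : u x = 0 := by nlinarith [sq_nonneg (u x), sq_nonneg (v x)]
  have hv0 : v x = 0 := by nlinarith [sq_nonneg (u x), sq_nonneg (v x)]
  exact ⟨sub_eq_zero.1 hu0, sub_eq_zero.1 hv0⟩

/-- Schläfli's integral representation of `Y_n`. -/
theorem schlaefliS_eq_pi_mul_besselY {x : ℝ} (hx : 0 < x) (n : ℕ) :
    schlaefliS n x = Real.pi * besselY n x := by
  -- Both sides obey the same three-term recurrence, so orders 0 and 1 determine the rest.
  induction n using Nat.twoStepInduction with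
  | zero => simpa using (schlaefliS_zero_one_eq hx).1
  | one => simpa using (schlaefliS_zero_one_eq hx).2
  | more n ih0 ih1 =>
    have h1 := schlaefliS_recurrence ((n : ℝ) + 1) hx
    have h2 := besselY_recurrence n hx
    rw [add_sub_cancel_right, show (n : ℝ) + 1 + 1 = ((n + 2 : ℕ) : ℝ) by push_cast; ring] at h1
    have ih1' : schlaefliS ((n : ℝ) + 1) x = Real.pi * besselY (n + 1) x := by
      rw [← ih1]
      push_cast
      rfl
    rw [ih0, ih1'] at h1
    linear_combination h1 - Real.pi * h2

/-! ### Sign of `Y_n`, monotonicity of `C_n`, and the bound for `Y_n` -/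

/-- `Y_n` is nonpositive on `(0, n]`. -/
theorem besselY_nonpos {n : ℕ} {x : ℝ} (hx : 0 < x) (hxn : x ≤ n) : besselY n x ≤ 0 := by
  have h1 := schlaefliS_le_schlaefliA (ν := n) n.cast_nonneg hx
  have h2 := schlaefliA_nonpos hx hxn
  rw [schlaefliS_eq_pi_mul_besselY hx] at h1
  exact nonpos_of_mul_nonpos_right (h1.trans h2) Real.pi_pos

/-- For `n ≥ x` the quantities `C_{n+1}(x)` decrease in `n`. -/
theorem besselC_succ_le {n : ℕ} {x : ℝ} (hx : 0 < x) (hxn : x ≤ n) :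
    besselC (n + 2) x ≤ besselC (n + 1) x := by
  have h0 := besselY_nonpos hx hxn
  have hr := besselY_recurrence n hx
  have hΓ1 : Real.Gamma ((n + 1 : ℕ) : ℝ) = n.factorial := by
    push_cast
    exact Real.Gamma_nat_eq_factorial n
  have hΓ2 : Real.Gamma ((n + 2 : ℕ) : ℝ) = (n + 1) * n.factorial := by
    rw [← factorial_succ_cast, ← Real.Gamma_nat_eq_factorial]
    push_cast
    ring_nf
  have hf : (0 : ℝ) < n.factorial := by positivity
  have hY : besselY (n + 2) x = 2 * (n + 1) / x * besselY (n + 1) x - besselY n x := by linarith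
  have e : besselC (n + 1) x - besselC (n + 2) x =
      -besselY n x * ((x / 2) ^ (n + 2) * (Real.pi / ((n + 1) * n.factorial))) := by
    rw [besselC, besselC, hΓ1, hΓ2, hY]
    field_simp
    ring
  have : 0 ≤ -besselY n x * ((x / 2) ^ (n + 2) * (Real.pi / ((n + 1) * n.factorial))) :=
    mul_nonneg (by linarith) (by have := Real.pi_pos; positivity)
  linarith

theorem besselC_add_le {n : ℕ} {x : ℝ} (hx : 0 < x) (hxn : x ≤ n) (k : ℕ) :
    besselC (n + k + 1) x ≤ besselC (n + 1) x := by
  induction k with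
  | zero => rfl
  | succ k ih =>
    refine le_trans (besselC_succ_le (n := n + k) hx ?_) ih
    push_cast
    linarith [k.cast_nonneg (α := ℝ)]

/-- Since `Y_N ≤ 0`, inverting the definition of `C_N` gives `|Y_N|` exactly; monotonicity then
replaces `C_N` by `C_{n+1}`. -/
theorem abs_besselY_le {n : ℕ} {x : ℝ} (hx : 0 < x) (hxn : x ≤ n) (k : ℕ) :
    |besselY (n + k + 1) x| ≤
      besselC (n + 1) x * ((2 / x) ^ (n + k + 1) * ((n + k).factorial : ℝ) / Real.pi) := by
  have h0 : besselY (n + k + 1) x ≤ 0 := by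
    refine besselY_nonpos hx ?_
    push_cast
    linarith [k.cast_nonneg (α := ℝ)]
  have hΓ : Real.Gamma ((n + k + 1 : ℕ) : ℝ) = (n + k).factorial := by
    rw [← Real.Gamma_nat_eq_factorial]
    push_cast
    rfl
  have e : |besselY (n + k + 1) x| = besselC (n + k + 1) x *
      ((2 / x) ^ (n + k + 1) * ((n + k).factorial : ℝ) / Real.pi) := by
    have h2 : (x / 2) ^ (n + k + 1) * (2 / x) ^ (n + k + 1) = 1 := by
      rw [← mul_pow, div_mul_div_comm, mul_comm, div_self (by positivity), one_pow]
    have hf : ((n + k).factorial : ℝ) ≠ 0 := by positivity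
    have hπ := Real.pi_ne_zero
    rw [abs_of_nonpos h0, besselC, hΓ]
    calc -besselY (n + k + 1) x = -besselY (n + k + 1) x *
          ((x / 2) ^ (n + k + 1) * (2 / x) ^ (n + k + 1)) *
          (Real.pi / (n + k).factorial * ((n + k).factorial / Real.pi)) := by
          rw [h2]
          field_simp
      _ = _ := by ring
  rw [e]
  exact mul_le_mul_of_nonneg_right (besselC_add_le hx hxn k)
    (by have := Real.pi_pos; positivity)

end Schlaefli

/-! ### Geometric sums of rising factorials and `α_{m,p}` -/

theorem ascFactorial_succ_sub (n j : ℕ) :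
    (((n + 1).ascFactorial (j + 1) : ℕ) : ℝ) - ((n.ascFactorial (j + 1) : ℕ) : ℝ) =
      (j + 1) * ((n + 1).ascFactorial j : ℕ) := by
  have h2 : n.ascFactorial (j + 1) = n * (n + 1).ascFactorial j := by
    rw [Nat.ascFactorial_succ, Nat.succ_ascFactorial]
  rw [h2, Nat.ascFactorial_succ]
  push_cast
  ring

theorem summable_pow_mul_ascFactorial {r : ℝ} (hr0 : 0 ≤ r) (hr1 : r < 1) (q j : ℕ) :
    Summable (fun k : ℕ => r ^ (q + k) * ((q + k + 1).ascFactorial j : ℕ)) := by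
  have h := summable_choose_mul_geometric_of_norm_lt_one j
    (r := r) (by rwa [Real.norm_eq_abs, abs_of_nonneg hr0])
  have h' := ((summable_nat_add_iff q).2 h).mul_left (j.factorial : ℝ)
  refine h'.congr fun k => ?_
  rw [Nat.ascFactorial_eq_factorial_mul_choose, add_comm q k]
  push_cast
  ring

/-- Weighted geometric sums of rising factorials are dominated by a homogeneous sum. -/
theorem tsum_pow_mul_ascFactorial_le {r b c : ℝ} (hr0 : 0 ≤ r) (hr1 : r < 1) (j : ℕ) :
    ∀ q : ℕ, 2 * ((q : ℝ) + j) ≤ b → 2 * j * r / (1 - r) ≤ c →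
    2 ^ j * (1 - r) * ∑' k : ℕ, r ^ (q + k) * ((q + k + 1).ascFactorial j : ℕ) ≤
      r ^ q * ∑ i ∈ Finset.range (j + 1), b ^ i * c ^ (j - i) := by
  have h1r : 0 < 1 - r := by linarith
  induction j with
  | zero =>
    intro q _ _
    simp only [Nat.ascFactorial_zero, pow_add, Nat.cast_one, mul_one, tsum_mul_left,
      tsum_geometric_of_lt_one hr0 hr1]
    simp
    field_simp
    simp
  | succ j ih =>
    intro q hb hc
    have hc0 : 0 ≤ c := le_trans (by positivity) hc
    have hq : (0 : ℝ) ≤ q := q.cast_nonneg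
    have hj : (0 : ℝ) ≤ j := j.cast_nonneg
    push_cast at hb hc
    have hb0 : 0 ≤ b := by linarith
    -- Lowering `j` while raising `q` preserves `q + j`, so the same `b` serves throughout the
    -- induction.
    have hih := ih (q + 1) (by push_cast; linarith) (le_trans (by gcongr; linarith) hc)
    set g := ∑ i ∈ Finset.range (j + 1), b ^ i * c ^ (j - i) with hg
    have hg0 : 0 ≤ g := Finset.sum_nonneg fun i _ => by positivity
    have hS := summable_pow_mul_ascFactorial hr0 hr1 q (j + 1)
    -- Abel summation: multiplying by `1 - r` differences the rising factorials, which lowers their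
    -- degree by one.
    have habel : (1 - r) * ∑' k : ℕ, r ^ (q + k) * ((q + k + 1).ascFactorial (j + 1) : ℕ) =
        r ^ q * ((q + 1).ascFactorial (j + 1) : ℕ) + (j + 1) *
          ∑' k : ℕ, r ^ (q + 1 + k) * ((q + 1 + k + 1).ascFactorial j : ℕ) := by
      have h1 := hS.tsum_eq_zero_add
      have hS' : Summable (fun k : ℕ => r ^ (q + (k + 1)) *
        ((q + (k + 1) + 1).ascFactorial (j + 1) : ℕ)) := (summable_nat_add_iff 1).2 hS
      have h2 : (j + 1) * ∑' k : ℕ, r ^ (q + 1 + k) * ((q + 1 + k + 1).ascFactorial j : ℕ) =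
          ∑' k : ℕ, r ^ (q + (k + 1)) * ((q + (k + 1) + 1).ascFactorial (j + 1) : ℕ) -
          r * ∑' k : ℕ, r ^ (q + k) * ((q + k + 1).ascFactorial (j + 1) : ℕ) := by
        rw [← tsum_mul_left, ← tsum_mul_left, ← hS'.tsum_sub (hS.mul_left r)]
        refine tsum_congr fun k => ?_
        have := ascFactorial_succ_sub (q + k + 1) j
        rw [show q + 1 + k = q + k + 1 by ring, show q + (k + 1) = q + k + 1 by ring]
        rw [pow_succ r (q + k)]
        linear_combination (-(r ^ (q + k) * r)) * this
      rw [h2, sub_mul, one_mul]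
      nth_rewrite 1 [h1]
      simp only [add_zero]
      ring
    have hfac : (2 : ℝ) ^ (j + 1) * ((q + 1).ascFactorial (j + 1) : ℕ) ≤ b ^ (j + 1) := by
      have h3 : (((q + 1).ascFactorial (j + 1) : ℕ) : ℝ) ≤ ((q : ℝ) + (j + 1)) ^ (j + 1) := by
        exact_mod_cast Nat.ascFactorial_le_pow_add q (j + 1)
      calc (2 : ℝ) ^ (j + 1) * ((q + 1).ascFactorial (j + 1) : ℕ)
          ≤ 2 ^ (j + 1) * ((q : ℝ) + (j + 1)) ^ (j + 1) := by gcongr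
        _ = (2 * ((q : ℝ) + (j + 1))) ^ (j + 1) := by rw [mul_pow]
        _ ≤ b ^ (j + 1) := by gcongr
    -- The homogeneous sums satisfy `g_{j+1} = b^(j+1) + c g_j`, matching the boundary term and the
    -- remaining sum of `habel`.
    rw [geom_sum₂_succ_eq]
    simp only [Nat.add_sub_cancel]
    rw [← hg]
    set T := ∑' k : ℕ, r ^ (q + 1 + k) * ((q + 1 + k + 1).ascFactorial j : ℕ)
    have hT : 2 ^ j * T ≤ r ^ (q + 1) * g / (1 - r) := by
      rw [le_div_iff₀ h1r]
      linarith
    calc _ = 2 ^ (j + 1) * ((1 - r) *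
          ∑' k : ℕ, r ^ (q + k) * ((q + k + 1).ascFactorial (j + 1) : ℕ)) := by ring
      _ = r ^ q * (2 ^ (j + 1) * ((q + 1).ascFactorial (j + 1) : ℕ)) +
          2 * (j + 1) * (2 ^ j * T) := by rw [habel]; ring
      _ ≤ r ^ q * b ^ (j + 1) + 2 * (j + 1) * (r ^ (q + 1) * g / (1 - r)) := by gcongr
      _ = r ^ q * b ^ (j + 1) + r ^ q * (2 * (j + 1) * r / (1 - r) * g) := by ring
      _ ≤ r ^ q * b ^ (j + 1) + r ^ q * (c * g) := by gcongr
      _ = _ := by ring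

/-- `α_{m,p}(r)` dominates the normalised sum `2^m (1-r) r^{-p-1} ∑_{n>p} r^n (n+m-1)!/n!`. -/
theorem summable_and_tsum_le_alphaCoef {r : ℝ} (hr0 : 0 ≤ r) (hr1 : r < 1) (m p : ℕ) :
    Summable (fun k : ℕ => 2 ^ m * (r ^ (p + 1 + k) *
        ((p + k + m).factorial : ℝ) / ((p + 1 + k).factorial : ℝ))) ∧
    ∑' k : ℕ, 2 ^ m * (r ^ (p + 1 + k) *
        ((p + k + m).factorial : ℝ) / ((p + 1 + k).factorial : ℝ)) ≤
      alphaCoef m p r * r ^ (p + 1) / (1 - r) := by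
  have h1r : 0 < 1 - r := by linarith
  rcases m with _ | j
  -- For `m = 0` the factorial quotient is `1/(p+k+1) ≤ 1/(p+1)`, leaving a geometric series.
  · have hle : ∀ k : ℕ, 2 ^ 0 * (r ^ (p + 1 + k) *
        ((p + k + 0).factorial : ℝ) / ((p + 1 + k).factorial : ℝ)) ≤
        r ^ (p + 1) / (p + 1) * r ^ k := by
      intro k
      have : ((p + k).factorial : ℝ) ≠ 0 := by positivity
      rw [show p + 1 + k = p + k + 1 by ring, factorial_succ_cast]
      have e : 2 ^ 0 * (r ^ (p + k + 1) * ((p + k + 0).factorial : ℝ) /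
        ((((p + k : ℕ) : ℝ) + 1) * ((p + k).factorial : ℝ))) =
        r ^ (p + 1) / (p + k + 1) * r ^ k := by
        push_cast
        simp only [add_zero, pow_add]
        field_simp
      rw [e]
      gcongr
      linarith [k.cast_nonneg (α := ℝ)]
    have hg := (summable_geometric_of_lt_one hr0 hr1).mul_left (r ^ (p + 1) / ((p : ℝ) + 1))
    have hs := Summable.of_nonneg_of_le (fun k => by positivity) hle hg
    refine ⟨hs, (hs.tsum_le_tsum hle hg).trans_eq ?_⟩
    rw [tsum_mul_left, tsum_geometric_of_lt_one hr0 hr1, alphaCoef, if_pos rfl]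
    field_simp
  · have he : ∀ k : ℕ, (2 : ℝ) ^ (j + 1) * (r ^ (p + 1 + k) *
        ((p + k + (j + 1)).factorial : ℝ) / ((p + 1 + k).factorial : ℝ)) =
        2 ^ (j + 1) * (r ^ (p + 1 + k) * ((p + 1 + k + 1).ascFactorial j : ℕ)) := by
      intro k
      rw [show p + k + (j + 1) = p + 1 + k + j by ring, ← Nat.factorial_mul_ascFactorial]
      have : ((p + 1 + k).factorial : ℝ) ≠ 0 := by positivity
      push_cast
      field_simp
    simp only [he]
    refine ⟨(summable_pow_mul_ascFactorial hr0 hr1 (p + 1) j).mul_left _, ?_⟩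
    -- With `m = j + 1` and `q = p + 1` the conditions read `2(p+m) ≤ b` and `2(m-1) r/(1-r) ≤ c`;
    -- both have slack.
    have h := tsum_pow_mul_ascFactorial_le (b := bCoef (j + 1) p) (c := cCoef (j + 1) r)
      hr0 hr1 j (p + 1) (by rw [bCoef]; push_cast; linarith)
      (by rw [cCoef]; gcongr; push_cast; linarith)
    -- The polynomial form covers both branches: at `b = c` it takes the limiting value `m b^(m-1)`.
    have hα : alphaCoef (j + 1) p r = 2 * ∑ i ∈ Finset.range (j + 1),
        bCoef (j + 1) p ^ i * cCoef (j + 1) r ^ (j - i) := by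
      rw [alphaCoef, if_neg (Nat.succ_ne_zero j)]
      split_ifs with hbc
      · rw [← hbc]
        have := geom_sum₂_self (bCoef (j + 1) p) (j + 1)
        simp only [Nat.add_sub_cancel] at this ⊢
        rw [this]
      · have := geom_sum₂_mul (bCoef (j + 1) p) (cCoef (j + 1) r) (j + 1)
        simp only [Nat.add_sub_cancel] at this
        rw [← this]
        have : bCoef (j + 1) p - cCoef (j + 1) r ≠ 0 := sub_ne_zero.2 hbc
        field_simp
    rw [hα, tsum_mul_left, le_div_iff₀ h1r]
    calc _ = 2 * (2 ^ j * (1 - r) *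
          ∑' k : ℕ, r ^ (p + 1 + k) * ((p + 1 + k + 1).ascFactorial j : ℕ)) := by ring
      _ ≤ 2 * (r ^ (p + 1) * ∑ i ∈ Finset.range (j + 1),
          bCoef (j + 1) p ^ i * cCoef (j + 1) r ^ (j - i)) := by gcongr
      _ = _ := by ring

/-! ### Assembly of the two bounds -/

theorem lemma7 (m p : ℕ) (x y : ℝ) (hy : 0 ≤ y) (hyx : y < x) (hx : x ≤ (p : ℝ) + m) :
    Summable (fun k : ℕ => |besselJ (p + 1 + k) y| * |besselY (p + 1 + k + m) x|) ∧
    ∑' k : ℕ, |besselJ (p + 1 + k) y| * |besselY (p + 1 + k + m) x| ≤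
      alphaCoef m p (y / x) * besselC (p + m + 1) x * (y / x) ^ (p + 1) /
        (Real.pi * x ^ m * (1 - y / x)) := by
  have hx0 : 0 < x := hy.trans_lt hyx
  have hr0 : 0 ≤ y / x := by positivity
  have hr1 : y / x < 1 := (div_lt_one hx0).2 hyx
  have hxn : x ≤ ((p + m : ℕ) : ℝ) := by
    push_cast
    exact hx
  obtain ⟨hs, hle⟩ := summable_and_tsum_le_alphaCoef hr0 hr1 m p
  set r := y / x with hr
  set K := besselC (p + m + 1) x / (Real.pi * x ^ m) with hK
  have hπ := Real.pi_pos
  have hC : 0 ≤ besselC (p + m + 1) x := by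
    have h := besselY_nonpos (n := p + m + 1) hx0 (by push_cast at hxn ⊢; linarith)
    have hΓ : 0 < Real.Gamma ((p + m + 1 : ℕ) : ℝ) := Real.Gamma_pos_of_pos (by positivity)
    have h' : 0 ≤ -besselY (p + m + 1) x := by linarith
    rw [besselC]
    positivity
  have hK0 : 0 ≤ K := by positivity
  -- With `n = p + 1 + k`, the factors `(y/2)^n (2/x)^n` give `r^n`; the surplus `(2/x)^m` supplies
  -- `2^m` and the `x^m` in `K`.
  have hterm : ∀ k : ℕ, |besselJ (p + 1 + k) y| * |besselY (p + 1 + k + m) x| ≤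
      K * (2 ^ m * (r ^ (p + 1 + k) *
        ((p + k + m).factorial : ℝ) / ((p + 1 + k).factorial : ℝ))) := by
    intro k
    have hJ := abs_besselJ_le (p + 1 + k) hy
    have hY := abs_besselY_le hx0 hxn k
    rw [show p + m + k + 1 = p + 1 + k + m by ring, show p + m + k = p + k + m by ring] at hY
    refine (mul_le_mul hJ hY (abs_nonneg _) (by positivity)).trans_eq ?_
    rw [hK, hr, pow_add (2 / x)]
    have h1 : (y / 2) ^ (p + 1 + k) * (2 / x) ^ (p + 1 + k) = (y / x) ^ (p + 1 + k) := by
      rw [← mul_pow]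
      congr 1
      field_simp
    rw [← h1, div_pow 2 x m]
    field_simp
  have hsum := hs.mul_left K
  have hs' := Summable.of_nonneg_of_le (fun k => by positivity) hterm hsum
  refine ⟨hs', ?_⟩
  calc _ ≤ ∑' k : ℕ, K * (2 ^ m * (r ^ (p + 1 + k) *
        ((p + k + m).factorial : ℝ) / ((p + 1 + k).factorial : ℝ))) := hs'.tsum_le_tsum hterm hsum
    _ = K * ∑' k : ℕ, 2 ^ m * (r ^ (p + 1 + k) *
        ((p + k + m).factorial : ℝ) / ((p + 1 + k).factorial : ℝ)) := tsum_mul_left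
    _ ≤ K * (alphaCoef m p r * r ^ (p + 1) / (1 - r)) := mul_le_mul_of_nonneg_left hle hK0
    _ = _ := by
      rw [hK]
      have : 0 < 1 - r := by linarith
      field_simp
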